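/- \textbf{Setting.} Identify the Euclidean plane $\mathbb{E}^2$ with $\mathrm{span}_{\mathbb R}\{\mathbf i,\mathbf j\}\subset\mathbb H$ via $(x,y)\leftrightarrow x\mathbf i+y\mathbf j$. For quaternions $F,G$ let $F^*$ be the conjugate, $\langle F,G\rangle=\mathrm{Re}(FG^*)$, and $\vec F$ the imaginary part. Let $\eta>0$ and let $F:\mathbb Z\to\mathbb{E}^2$ be a regular discrete arc-length curve: $|F_{n+1}-F_n|=\eta$ and $F_{n-1}\ne F_{n+1}$ for all $n$. Put $u_{n,n+1}=F_{n+1}-F_n$, and let the curvature $\kappa_n$ be the signed curvature of the circle touching the two oriented edges at $F_n$ in their midpoints, i.e. $\tfrac{\kappa_n}{2}(F_{n+1}-F_{n-1})=\tfrac1\eta\mathbf k(u_{n-1,n}-u_{n,n+1})$. The curve is \emph{area-constrained elastic} if there are $\xi\in\mathbb R$ and $\delta\in\mathbb R\setminus\{0\}$ with $$\kappa_{n-1}+\kappa_{n+1}=\frac{\xi\kappa_n+\delta}{1+\frac{\eta^2}{4}\kappa_n^2}\qquad\text{for all }n.$$ Let $T_n=2(u_{n-1,n}^{-1}+u_{n,n+1}^{-1})^{-1}$,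 $H_n=u_{n,n+1}^{-1}T_n$, $S_{n,n+1}=H_{n+1}H_n^*$. The semi-discrete tangent flow and mKdV flow are $F^T_n=T_n$ and $F^{mKdV}_n=\frac12(S_{n-1,n}+S_{n,n+1})T_n$. A curve is \emph{invariant} under a flow given by a vector field $V$ if there is a one-parameter group $(\varphi_t)_{t\in\mathbb R}$ of Euclidean motions such that $t\mapsto\varphi_t\circ F$ solves $\partial_tF_n=V(F)_n$. Two curves $f,g$ are related by a \emph{B\"acklund transformation} if for every $n$ the quad $(f_n,f_{n+1},g_{n+1},g_n)$ has non-vanishing diagonals ($f_n\neq g_{n+1}$, $f_{n+1}\neq g_n$) and the reflection in some line interchanges $f_n\leftrightarrow g_{n+1}$ and $f_{n+1}\leftrightarrow g_n$. A \emph{closing sequence} for $F$ consists of regular discrete arc-length curves $F=F^{(0)},F^{(1)},F^{(2)},F^{(3)}$ with edge length $\eta$, consecutive ones being related by B\"acklund transformations, together with $E\in\mathrm{span}\{\mathbf 1,\mathbf k\}\setminus\{0\}$ and $c\in\mathbb{E}^2$ such that $F^{(3)}_n=E^{-1}F_nE+c$ for all $n$. With $v^{(i)}_n=F^{(i+1)}_n-F^{(i)}_n$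 put $$\mathcal P_n(\lambda)=E(1+\lambda v^{(2)}_n)(1+\lambda v^{(1)}_n)(1+\lambda v^{(0)}_n)=\sum_{j=0}^3\lambda^jC^j_n,\qquad \theta_j=\sum_{k}\langle\vec C^k_n,\vec C^{j-k}_n\rangle ,$$ so that $\det\vec{\mathcal P}_n(\lambda)=\sum_{j=0}^{6}\theta_j\lambda^j$. The sequence is \emph{regular} if $\vec{\mathcal P}\neq0$, and \emph{nondegenerate} if $\det\vec{\mathcal P}_n(i/\eta)\ne0$ for all $n$. \textbf{Proposition.} Let $F$ be an area-constrained elastic curve as above. Then $F$ is invariant under $a\,F^{mKdV}+b\,F^T$ for some constants $a,b\in\mathbb R$ with $a\neq0$. More precisely: \begin{enumerate} \item There is a regular nondegenerate closing sequence for $F$ with $\vec E\neq0$. \item If $\kappa$ is not constant, every regular closing sequence for $F$ is nondegenerate. \item For every regular nondegenerate closing sequence the numbers $\theta_j$ do not depend on $n$, and there is a constant $\beta\in\mathbb R\setminus\{0\}$ with $\beta^2=-\eta^4\det\vec{\mathcal P}_n(i/\eta)$ and $C^3_n-\eta^2C^1_n=\beta T_n$ for all $n$, such that for all $n$ $$C^1_n=-\frac{\beta}{2\eta^2}F^{mKdV}_n+\frac{1}{2\beta\eta^4}\bigl(\theta_6-\eta^4\theta_2+2\eta^6\theta_0\bigr)F^T_n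 .$$ The field $C^1$ is the restriction of an infinitesimal Euclidean motion, $C^1_n=F_nE-EF_n+c'$ with $c'\in\mathbb{E}^2$ constant, and $F$ is invariant under the flow with the same constant coefficients, $-\frac{\beta}{2\eta^2}F^{mKdV}+\frac{1}{2\beta\eta^4}(\theta_6-\eta^4\theta_2+2\eta^6\theta_0)F^T$. \end{enumerate} -/

import Mathlib

open scoped Quaternion

noncomputable section

namespace DiscreteCurve

/-- The Euclidean plane `𝔼²`. -/
abbrev Plane : Type := EuclideanSpace ℝ (Fin 2)

/-- The identification `(x, y) ↔ x 𝐢 + y 𝐣` of the plane with a plane in the quaternions. -/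
def toQuat (p : Plane) : ℍ[ℝ] := ⟨0, p 0, p 1, 0⟩

@[simp] theorem toQuat_re (p : Plane) : (toQuat p).re = 0 := rfl
@[simp] theorem toQuat_imI (p : Plane) : (toQuat p).imI = p 0 := rfl
@[simp] theorem toQuat_imJ (p : Plane) : (toQuat p).imJ = p 1 := rfl
@[simp] theorem toQuat_imK (p : Plane) : (toQuat p).imK = 0 := rfl

/-- The quaternion unit `𝐤`. -/
def quatK : ℍ[ℝ] := ⟨0, 0, 0, 1⟩

@[simp] theorem quatK_re : quatK.re = 0 := rfl
@[simp] theorem quatK_imI : quatK.imI = 0 := rfl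
@[simp] theorem quatK_imJ : quatK.imJ = 0 := rfl
@[simp] theorem quatK_imK : quatK.imK = 1 := rfl

/-! ### Discrete arc-length curves and their curvature -/

/-- Regular discrete curves `f : ℤ → 𝔼²` with constant edge length `η > 0`: any three
consecutive points are pairwise distinct. -/
structure IsArcLengthCurve (η : ℝ) (f : ℤ → Plane) : Prop where
  pos : 0 < η
  dist_eq : ∀ n, dist (f n) (f (n + 1)) = η
  regular : ∀ n, f (n - 1) ≠ f (n + 1)

/-- The edge (transport) quaternion `u_{n,n+1} = F_{n+1} - F_n`. -/
def edge (f : ℤ → Plane) (n : ℤ) : ℍ[ℝ] := toQuat (f (n + 1)) - toQuat (f n)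

/-- The unit normal `𝐤 u / |u|` of the edge from `f n` to `f (n + 1)`, which is oriented in
curve direction. -/
def edgeNormal (f : ℤ → Plane) (n : ℤ) : ℍ[ℝ] := ‖edge f n‖⁻¹ • (quatK * edge f n)

/-- The signed curvature `κ_n`. It is the curvature `1 / r` of the oriented circle that touches
the two oriented edges at `f n` in their midpoints `m_-` and `m_+`, so that its centre is
`m_- + r N_- = m_+ + r N_+`, where `N_-`, `N_+` are the edge normals. As
`m_+ - m_- = (f (n + 1) - f (n - 1)) / 2`, this says
`(κ / 2) (F_{n+1} - F_{n-1}) = N_- - N_+`, see `curvature_spec`. -/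
def curvature (f : ℤ → Plane) (n : ℤ) : ℝ :=
  2 * inner ℝ (edgeNormal f (n - 1) - edgeNormal f n) (toQuat (f (n + 1)) - toQuat (f (n - 1)))
    / ‖toQuat (f (n + 1)) - toQuat (f (n - 1))‖ ^ 2

theorem dist_eq_norm_toQuat (p q : Plane) : dist p q = ‖toQuat q - toQuat p‖ := by
  rw [dist_comm, EuclideanSpace.dist_eq, ← Real.sqrt_sq (norm_nonneg (toQuat q - toQuat p)), sq,
    ← Quaternion.normSq_eq_norm_mul_self, Quaternion.normSq_def']
  simp [Real.dist_eq, Fin.sum_univ_two]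

/-- For a regular arc-length curve, `κ_n` is the unique number for which the tangent circle
condition holds. -/
theorem curvature_spec {η : ℝ} {f : ℤ → Plane} (hf : IsArcLengthCurve η f) (n : ℤ) (κ : ℝ) :
    (κ / 2) • (toQuat (f (n + 1)) - toQuat (f (n - 1))) = edgeNormal f (n - 1) - edgeNormal f n
      ↔ κ = curvature f n := by
  have hu : ‖edge f (n - 1)‖ = η := by rw [edge, ← dist_eq_norm_toQuat, hf.dist_eq]
  have hw : ‖edge f n‖ = η := by rw [edge, ← dist_eq_norm_toQuat, hf.dist_eq]
  have hD : 0 < ‖toQuat (f (n + 1)) - toQuat (f (n - 1))‖ := by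
    rw [← dist_eq_norm_toQuat]; exact dist_pos.2 (hf.regular n)
  have hD' : toQuat (f (n + 1)) - toQuat (f (n - 1)) ≠ 0 := norm_pos_iff.1 hD
  have hsq : ‖edge f (n - 1)‖ * ‖edge f (n - 1)‖ = ‖edge f n‖ * ‖edge f n‖ := by rw [hu, hw]
  rw [← Quaternion.normSq_eq_norm_mul_self, ← Quaternion.normSq_eq_norm_mul_self,
    Quaternion.normSq_def', Quaternion.normSq_def'] at hsq
  have key : ‖toQuat (f (n + 1)) - toQuat (f (n - 1))‖ ^ 2 •
      (edgeNormal f (n - 1) - edgeNormal f n) =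
      inner ℝ (edgeNormal f (n - 1) - edgeNormal f n) (toQuat (f (n + 1)) - toQuat (f (n - 1))) •
        (toQuat (f (n + 1)) - toQuat (f (n - 1))) := by
    rw [edgeNormal, edgeNormal, hu, hw, sq, ← Quaternion.normSq_eq_norm_mul_self,
      Quaternion.normSq_def', Quaternion.inner_def]
    simp only [edge, sub_add_cancel] at hsq ⊢
    ext <;> simp at hsq ⊢
    · linear_combination (-η⁻¹ * (f (n + 1) 1 - f (n - 1) 1)) * hsq
    · linear_combination (η⁻¹ * (f (n + 1) 0 - f (n - 1) 0)) * hsq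
  have hM : edgeNormal f (n - 1) - edgeNormal f n =
      (curvature f n / 2) • (toQuat (f (n + 1)) - toQuat (f (n - 1))) := by
    have h2 := congrArg
      (fun q => (‖toQuat (f (n + 1)) - toQuat (f (n - 1))‖ ^ 2)⁻¹ • q) key
    simp only [smul_smul] at h2
    rw [inv_mul_cancel₀ (by positivity), one_smul] at h2
    rw [h2, curvature]
    congr 1
    ring
  rw [hM]
  constructor
  · intro h
    have := smul_left_injective ℝ hD' h
    linarith
  · rintro rfl
    rfl

/-- The discrete area-constrained elastic curves in the Euclidean plane. -/
def IsAreaConstrainedElastic (η : ℝ) (f : ℤ → Plane) : Prop :=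
  ∃ ξ δ : ℝ, δ ≠ 0 ∧ ∀ n, curvature f (n - 1) + curvature f (n + 1) =
    (ξ * curvature f n + δ) / (1 + η ^ 2 / 4 * curvature f n ^ 2)

/-! ### Tangent flow and mKdV flow -/

/-- The vertex tangent vector `T_n`, the harmonic mean of the adjacent edges. As a vector field
on curves it is the semi-discrete tangent flow. -/
def tangentFlow (f : ℤ → Plane) (n : ℤ) : ℍ[ℝ] :=
  2 * ((edge f (n - 1))⁻¹ + (edge f n)⁻¹)⁻¹

/-- `H_n = u_{n,n+1}⁻¹ T_n`. -/
def vertexH (f : ℤ → Plane) (n : ℤ) : ℍ[ℝ] := (edge f n)⁻¹ * tangentFlow f n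

/-- The discrete Schwarzian derivative `S_{n,n+1} = H_{n+1} H_n^*`. -/
def schwarzian (f : ℤ → Plane) (n : ℤ) : ℍ[ℝ] := vertexH f (n + 1) * star (vertexH f n)

/-- The semi-discrete mKdV flow `½ (S_{n-1,n} + S_{n,n+1}) T_n`. -/
def mKdVFlow (f : ℤ → Plane) (n : ℤ) : ℍ[ℝ] :=
  (1 / 2 : ℝ) • ((schwarzian f (n - 1) + schwarzian f n) * tangentFlow f n)

/-- The curve `f` is invariant under the flow `∂_t f_n = V(f)_n`: the flow line through `f` is
`t ↦ φ_t ∘ f` for a one-parameter group `φ` of Euclidean motions. -/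
def IsInvariantUnderFlow (V : (ℤ → Plane) → ℤ → ℍ[ℝ]) (f : ℤ → Plane) : Prop :=
  ∃ φ : ℝ → (Plane ≃ᵃⁱ[ℝ] Plane),
    (∀ s t x, φ (s + t) x = φ s (φ t x)) ∧
    ∀ t n, HasDerivAt (fun s => toQuat (φ s (f n))) (V (fun m => φ t (f m)) n) t

/-! ### Bäcklund transformations and 3-invariance -/

/-- The quad `(a, b, c, d)` has non-vanishing diagonals, and the reflection in some line
interchanges `a ↔ c` and `b ↔ d`. The line runs through `p` and is orthogonal to `v`. -/
def IsDarbouxButterfly (a b c d : Plane) : Prop :=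
  a ≠ c ∧ b ≠ d ∧ ∃ p v : Plane, v ≠ 0 ∧
    EuclideanGeometry.reflection (AffineSubspace.mk' p (ℝ ∙ v)ᗮ) a = c ∧
    EuclideanGeometry.reflection (AffineSubspace.mk' p (ℝ ∙ v)ᗮ) b = d

/-- The curves `f` and `g` are related by a Bäcklund transformation. -/
def IsBacklund (f g : ℤ → Plane) : Prop :=
  ∀ n, IsDarbouxButterfly (f n) (f (n + 1)) (g (n + 1)) (g n)

/-- A sequence `f = f⁽⁰⁾, f⁽¹⁾, f⁽²⁾, f⁽³⁾` of three Bäcklund transformations such that `f⁽³⁾` is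
the image of `f` under the orientation preserving isometry `F ↦ E⁻¹ F E + c`, `E ∈ span(𝟏, 𝐤)`. -/
structure ThreeStep (η : ℝ) (f : ℤ → Plane) where
  seq : Fin 4 → ℤ → Plane
  E : ℍ[ℝ]
  shift : Plane
  seq_zero : seq 0 = f
  curve : ∀ i, IsArcLengthCurve η (seq i)
  backlund : ∀ i : Fin 3, IsBacklund (seq i.castSucc) (seq i.succ)
  E_ne_zero : E ≠ 0
  E_imI : E.imI = 0
  E_imJ : E.imJ = 0
  isometry : ∀ n, toQuat (seq 3 n) = E⁻¹ * toQuat (f n) * E + toQuat shift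

namespace ThreeStep

variable {η : ℝ} {f : ℤ → Plane}

/-- The transport quaternion `v⁽ⁱ⁾_n = F⁽ⁱ⁺¹⁾_n - F⁽ⁱ⁾_n` in transformation direction. -/
def v (S : ThreeStep η f) (i : Fin 3) (n : ℤ) : ℍ[ℝ] :=
  toQuat (S.seq i.succ n) - toQuat (S.seq i.castSucc n)

open Polynomial in
/-- The polynomial `𝒫_n(λ) = E (1 + λ v⁽²⁾_n) (1 + λ v⁽¹⁾_n) (1 + λ v⁽⁰⁾_n)` in a central
variable `λ`. -/
def poly (S : ThreeStep η f) (n : ℤ) : Polynomial ℍ[ℝ] :=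
  C S.E * (1 + X * C (S.v 2 n)) * (1 + X * C (S.v 1 n)) * (1 + X * C (S.v 0 n))

/-- The coefficient `C^j_n` of `λ^j` in `𝒫_n`. -/
def coeff (S : ThreeStep η f) (j : ℕ) (n : ℤ) : ℍ[ℝ] := (S.poly n).coeff j

/-- The sequence is regular if `𝒫` is not scalar. A curve is 3-invariant if it admits a regular
`ThreeStep`. -/
def IsRegular (S : ThreeStep η f) : Prop := ∃ n j, (S.coeff j n).im ≠ 0

/-- The coefficient `θ_j` of `λ^j` in the determinant of the trace-free part of `𝒫_n`. -/
def theta (S : ThreeStep η f) (j : ℕ) (n : ℤ) : ℝ :=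
  ∑ k ∈ Finset.range (j + 1), inner ℝ (S.coeff k n).im (S.coeff (j - k) n).im

/-- The value at `λ = i / η` of the determinant of the trace-free part of `𝒫_n`, which has degree
at most 6 in `λ`. -/
def detVec (S : ThreeStep η f) (n : ℤ) : ℂ :=
  ∑ j ∈ Finset.range 7, (S.theta j n : ℂ) * (Complex.I / (η : ℂ)) ^ j

/-- The determinant of the trace-free part of `𝒫_n` does not vanish at `λ = i / η`. -/
def IsNondegenerate (S : ThreeStep η f) : Prop := ∀ n, S.detVec n ≠ 0

end ThreeStep

end DiscreteCurve

end

open DiscreteCurve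

open scoped Quaternion

noncomputable section

namespace DiscreteCurve

open scoped ComplexConjugate
open Complex (I)

/-! Writing ℍ as ℂ ⊕ ℂ𝐢 turns `span {𝟏, 𝐤}` and `span {𝐢, 𝐣}` into two copies of ℂ and every
quaternionic identity into a complex one with conjugations. With K = ηκ/2 the edges satisfy (1 +
iK_n) u_{n-1} = (1 - iK_n) u_n, and T_n = (1 - iK_n) u_n.

A butterfly is the refactorization (1 + λv_{n+1})(1 + λu_n) = (1 + λu'_n)(1 + λv_n), where u' is the
edge of the transformed curve. Three of them and the closing isometry give 𝒫_{n+1}(1 + λu_n) = (1 +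
λu_n)𝒫_n (`ThreeStep.intertwines`). So 𝒫_n changes by conjugation, and the θ_j are constant. At λ =
i/η the factor 1 + λu_n is singular, which fixes the trace-free part of 𝒫_n up to a scalar β and
yields C³ - η²C¹ = βT (`ClosedCoordinates.exists_beta`). Solving the remaining equations for C¹
gives the combination of mKdV and tangent flow (`ClosedCoordinates.coordinates_eq`). The
λ-coefficient of the intertwining relation says that C¹ is an infinitesimal motion; since both flows
are equivariant under orientation preserving motions, it integrates to invariance.

For existence, the elastic equation is exactly what makes an explicit trace-free polynomial of
degree three with β = 2η² intertwine the curve with itself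
(`IsAreaConstrainedElastic.exists_closedCoordinates`). Adding the scalar ρ(λ² + 1/η²) preserves
this. As the determinant of the trace-free part is negative at λ² = -1/η², a large ρ creates enough
simple negative zeros in λ² (`exists_real_zeros`). Each zero splits off a factor 1 + λv, hence a
Bäcklund transformation (`Intertwines.exists_factor`). -/

/-! ### The plane and the quaternions in complex coordinates -/

/-- The plane as the complex line. -/
def toComplex (p : Plane) : ℂ := ⟨p 0, p 1⟩

/-- The point of the plane with a given complex coordinate. -/
def ofComplex (z : ℂ) : Plane := !₂[z.re, z.im]

@[simp] theorem toComplex_ofComplex (z : ℂ) : toComplex (ofComplex z) = z := by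
  simp [toComplex, ofComplex]

@[simp] theorem ofComplex_toComplex (p : Plane) : ofComplex (toComplex p) = p := by
  ext i; fin_cases i <;> simp [toComplex, ofComplex]

theorem toComplex_injective : Function.Injective toComplex :=
  Function.LeftInverse.injective ofComplex_toComplex

@[simp] theorem toComplex_add (p q : Plane) : toComplex (p + q) = toComplex p + toComplex q := by
  apply Complex.ext <;> simp [toComplex]

@[simp] theorem toComplex_sub (p q : Plane) : toComplex (p - q) = toComplex p - toComplex q := by
  apply Complex.ext <;> simp [toComplex]

@[simp] theorem toComplex_smul (r : ℝ) (p : Plane) : toComplex (r • p) = r * toComplex p := by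
  apply Complex.ext <;> simp [toComplex]

theorem dist_eq_norm_toComplex (p q : Plane) : dist p q = ‖toComplex q - toComplex p‖ := by
  rw [dist_comm, EuclideanSpace.dist_eq, Complex.norm_eq_sqrt_sq_add_sq]
  simp [Real.dist_eq, Fin.sum_univ_two, toComplex]

theorem inner_eq_re_mul_conj (p q : Plane) :
    inner ℝ p q = (toComplex p * conj (toComplex q)).re := by
  simp [PiLp.inner_apply, Fin.sum_univ_two, toComplex]
  ring

/-- The embedding of `ℂ` in `ℍ` with image `span {𝟏, 𝐤}`. -/
def evenQuat (z : ℂ) : ℍ[ℝ] := ⟨z.re, 0, 0, z.im⟩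

/-- The embedding of `ℂ` in `ℍ` with image `span {𝐢, 𝐣}`. -/
def oddQuat (z : ℂ) : ℍ[ℝ] := ⟨0, z.re, z.im, 0⟩

@[simp] theorem evenQuat_re (z : ℂ) : (evenQuat z).re = z.re := rfl
@[simp] theorem evenQuat_imI (z : ℂ) : (evenQuat z).imI = 0 := rfl
@[simp] theorem evenQuat_imJ (z : ℂ) : (evenQuat z).imJ = 0 := rfl
@[simp] theorem evenQuat_imK (z : ℂ) : (evenQuat z).imK = z.im := rfl
@[simp] theorem oddQuat_re (z : ℂ) : (oddQuat z).re = 0 := rfl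
@[simp] theorem oddQuat_imI (z : ℂ) : (oddQuat z).imI = z.re := rfl
@[simp] theorem oddQuat_imJ (z : ℂ) : (oddQuat z).imJ = z.im := rfl
@[simp] theorem oddQuat_imK (z : ℂ) : (oddQuat z).imK = 0 := rfl

theorem toQuat_eq (p : Plane) : toQuat p = oddQuat (toComplex p) := rfl

theorem oddQuat_injective : Function.Injective oddQuat := fun _ _ h =>
  Complex.ext (congrArg QuaternionAlgebra.imI h) (congrArg QuaternionAlgebra.imJ h)

theorem evenQuat_mul_evenQuat (z w : ℂ) : evenQuat z * evenQuat w = evenQuat (z * w) := by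
  ext <;> simp

theorem evenQuat_mul_oddQuat (z w : ℂ) : evenQuat z * oddQuat w = oddQuat (z * w) := by
  ext <;> simp

theorem oddQuat_mul_evenQuat (z w : ℂ) : oddQuat z * evenQuat w = oddQuat (z * conj w) := by
  ext <;> simp

theorem oddQuat_mul_oddQuat (z w : ℂ) : oddQuat z * oddQuat w = evenQuat (-(z * conj w)) := by
  ext <;> simp <;> ring

theorem evenQuat_add (z w : ℂ) : evenQuat (z + w) = evenQuat z + evenQuat w := by ext <;> simp
theorem oddQuat_add (z w : ℂ) : oddQuat (z + w) = oddQuat z + oddQuat w := by ext <;> simp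
theorem oddQuat_sub (z w : ℂ) : oddQuat (z - w) = oddQuat z - oddQuat w := by ext <;> simp

theorem smul_oddQuat (r : ℝ) (z : ℂ) : r • oddQuat z = oddQuat (r * z) := by ext <;> simp

theorem star_evenQuat (z : ℂ) : star (evenQuat z) = evenQuat (conj z) := by ext <;> simp

theorem evenQuat_inv (z : ℂ) : (evenQuat z)⁻¹ = evenQuat z⁻¹ := by
  rw [Quaternion.inv_def, Quaternion.normSq_def']
  ext <;> simp [Complex.normSq_apply, Complex.inv_re, Complex.inv_im] <;> ring

theorem oddQuat_inv (z : ℂ) : (oddQuat z)⁻¹ = oddQuat (-(conj z)⁻¹) := by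
  rw [Quaternion.inv_def, Quaternion.normSq_def']
  ext <;> simp [Complex.normSq_apply, Complex.inv_re, Complex.inv_im] <;> ring

/-- The embedding `oddQuat` as a continuous linear map. -/
def oddQuatCLM : ℂ →L[ℝ] ℍ[ℝ] :=
  LinearMap.toContinuousLinearMap
    { toFun := oddQuat
      map_add' := oddQuat_add
      map_smul' := fun r z => by rw [RingHom.id_apply, smul_oddQuat, Complex.real_smul] }

@[simp] theorem oddQuatCLM_apply (z : ℂ) : oddQuatCLM z = oddQuat z := rfl

/-! ### Edges, curvature and flows in complex coordinates -/

/-- The complex coordinate of the edge from `f n` to `f (n + 1)`. -/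
def cEdge (f : ℤ → Plane) (n : ℤ) : ℂ := toComplex (f (n + 1)) - toComplex (f n)

/-- The complex coordinate of the vertex tangent vector. -/
def cTangent (f : ℤ → Plane) (n : ℤ) : ℂ := 2 * ((cEdge f (n - 1))⁻¹ + (cEdge f n)⁻¹)⁻¹

/-- The complex coordinate of `H_n`. -/
def cVertex (f : ℤ → Plane) (n : ℤ) : ℂ := conj (cTangent f n / cEdge f n)

/-- The complex coordinate of the mKdV flow. -/
def cMKdV (f : ℤ → Plane) (n : ℤ) : ℂ :=
  1 / 2 * (cVertex f n * conj (cVertex f (n - 1)) + cVertex f (n + 1) * conj (cVertex f n)) *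
    cTangent f n

theorem edge_eq (f : ℤ → Plane) (n : ℤ) : edge f n = oddQuat (cEdge f n) := by
  rw [edge, toQuat_eq, toQuat_eq, cEdge, oddQuat_sub]

theorem tangentFlow_eq (f : ℤ → Plane) (n : ℤ) : tangentFlow f n = oddQuat (cTangent f n) := by
  have h2 : (2 : ℍ[ℝ]) = evenQuat 2 := by
    rw [← one_add_one_eq_two, ← one_add_one_eq_two, evenQuat_add]
    ext <;> simp
  rw [tangentFlow, edge_eq, edge_eq, oddQuat_inv, oddQuat_inv, ← oddQuat_add, oddQuat_inv, h2,
    evenQuat_mul_oddQuat, cTangent]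
  congr 2
  rw [← neg_add, map_neg, map_add, map_inv₀, map_inv₀, Complex.conj_conj, Complex.conj_conj,
    inv_neg, neg_neg]

theorem vertexH_eq (f : ℤ → Plane) (n : ℤ) : vertexH f n = evenQuat (cVertex f n) := by
  rw [vertexH, edge_eq, tangentFlow_eq, oddQuat_inv, oddQuat_mul_oddQuat, cVertex, map_div₀]
  congr 1
  ring

theorem schwarzian_eq (f : ℤ → Plane) (n : ℤ) :
    schwarzian f n = evenQuat (cVertex f (n + 1) * conj (cVertex f n)) := by
  rw [schwarzian, vertexH_eq, vertexH_eq, star_evenQuat, evenQuat_mul_evenQuat]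

theorem mKdVFlow_eq (f : ℤ → Plane) (n : ℤ) : mKdVFlow f n = oddQuat (cMKdV f n) := by
  rw [mKdVFlow, schwarzian_eq, schwarzian_eq, tangentFlow_eq, ← evenQuat_add,
    evenQuat_mul_oddQuat, smul_oddQuat, cMKdV, sub_add_cancel]
  congr 1
  push_cast
  ring

theorem flow_eq (f : ℤ → Plane) (n : ℤ) (a b : ℝ) :
    a • mKdVFlow f n + b • tangentFlow f n = oddQuat (a * cMKdV f n + b * cTangent f n) := by
  rw [mKdVFlow_eq, tangentFlow_eq, smul_oddQuat, smul_oddQuat, oddQuat_add]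

namespace IsArcLengthCurve

variable {η : ℝ} {f : ℤ → Plane}

theorem norm_cEdge (hf : IsArcLengthCurve η f) (n : ℤ) : ‖cEdge f n‖ = η := by
  rw [cEdge, ← dist_eq_norm_toComplex, hf.dist_eq]

theorem cEdge_ne_zero (hf : IsArcLengthCurve η f) (n : ℤ) : cEdge f n ≠ 0 := by
  rw [← norm_pos_iff, hf.norm_cEdge]; exact hf.pos

theorem cEdge_mul_conj (hf : IsArcLengthCurve η f) (n : ℤ) : cEdge f n * conj (cEdge f n) = (η : ℂ) ^ 2 := by
  rw [Complex.mul_conj', hf.norm_cEdge]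

theorem cEdge_add_ne_zero (hf : IsArcLengthCurve η f) (n : ℤ) : cEdge f (n - 1) + cEdge f n ≠ 0 := by
  intro h
  apply hf.regular n
  apply toComplex_injective
  rw [cEdge, cEdge, sub_add_cancel] at h
  linear_combination -h

/-- The tangent circle condition, solved for the turning of the edges: the exterior angle is 2
arctan(ηκ/2). -/
theorem cEdge_rotation (hf : IsArcLengthCurve η f) (n : ℤ) :
    (1 + I * (η / 2 * curvature f n : ℝ)) * cEdge f (n - 1) =
      (1 - I * (η / 2 * curvature f n : ℝ)) * cEdge f n := by
  have h := (curvature_spec hf n (curvature f n)).2 rfl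
  have hs : toQuat (f (n + 1)) - toQuat (f (n - 1)) =
      oddQuat (cEdge f (n - 1) + cEdge f n) := by
    rw [toQuat_eq, toQuat_eq, ← oddQuat_sub, cEdge, cEdge, sub_add_cancel]
    congr 1
    ring
  have hn : ∀ m, edgeNormal f m = oddQuat ((η : ℂ)⁻¹ * (I * cEdge f m)) := by
    intro m
    have hk : quatK = evenQuat I := by ext <;> simp
    have he : ‖edge f m‖ = η := by rw [edge, ← dist_eq_norm_toQuat, hf.dist_eq]
    rw [edgeNormal, he, edge_eq, hk, evenQuat_mul_oddQuat, smul_oddQuat, Complex.ofReal_inv]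
  rw [hs, hn, hn, ← oddQuat_sub, smul_oddQuat] at h
  have h' := oddQuat_injective h
  have hη : (η : ℂ) ≠ 0 := by exact_mod_cast hf.pos.ne'
  have h2 : (η : ℂ) * ((curvature f n / 2 : ℝ) * (cEdge f (n - 1) + cEdge f n)) =
      I * cEdge f (n - 1) - I * cEdge f n := by
    rw [h']; field_simp
  push_cast at h2 ⊢
  linear_combination I * h2 + (cEdge f (n - 1) - cEdge f n) * Complex.I_sq

theorem cTangent_eq (hf : IsArcLengthCurve η f) (n : ℤ) :
    cTangent f n = (1 - I * (η / 2 * curvature f n : ℝ)) * cEdge f n := by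
  have h0 := hf.cEdge_ne_zero (n - 1)
  have h1 := hf.cEdge_ne_zero n
  have h2 := hf.cEdge_add_ne_zero n
  have h := hf.cEdge_rotation n
  have h3 : cTangent f n = 2 * (cEdge f (n - 1) * cEdge f n) / (cEdge f (n - 1) + cEdge f n) := by
    rw [cTangent, inv_add_inv h0 h1, inv_div, ← mul_div_assoc]
  rw [h3, div_eq_iff h2]
  linear_combination cEdge f n * h

theorem cVertex_eq (hf : IsArcLengthCurve η f) (n : ℤ) : cVertex f n = 1 + I * (η / 2 * curvature f n : ℝ) := by
  rw [cVertex, hf.cTangent_eq, mul_div_cancel_right₀ _ (hf.cEdge_ne_zero n), map_sub,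
    map_one, map_mul, Complex.conj_I, Complex.conj_ofReal]
  ring

theorem cMKdV_eq (hf : IsArcLengthCurve η f) (n : ℤ) : cMKdV f n = (1 + (η / 2 * curvature f n) *
      (η / 2 * curvature f (n - 1) + η / 2 * curvature f (n + 1)) / 2 +
      I * ((η / 2 * curvature f (n + 1) - η / 2 * curvature f (n - 1)) / 2)) * cTangent f n := by
  rw [cMKdV, hf.cVertex_eq, hf.cVertex_eq, hf.cVertex_eq]
  congr 1
  simp only [map_add, map_one, map_mul, Complex.conj_I, Complex.conj_ofReal]
  push_cast
  linear_combination (-(η / 2 * curvature f n) *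
      (η / 2 * curvature f (n - 1) + η / 2 * curvature f (n + 1)) / 2 : ℂ) * Complex.I_sq

end IsArcLengthCurve

/-! ### Infinitesimal motions -/

/-- The orientation preserving motion `z ↦ μ z + τ` of the plane. -/
theorem exists_motion (μ : Circle) (τ : ℂ) :
    ∃ e : Plane ≃ᵃⁱ[ℝ] Plane, ∀ x, toComplex (e x) = μ * toComplex x + τ := by
  let L : ℂ ≃ₗᵢ[ℝ] Plane := Complex.orthonormalBasisOneI.repr
  have hL : ∀ z, toComplex (L z) = z := by
    intro z
    apply Complex.ext <;> simp [toComplex, L]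
  refine ⟨((L.symm.trans (rotation μ)).trans L).toAffineIsometryEquiv.trans
    (AffineIsometryEquiv.constVAdd ℝ Plane (ofComplex τ)), fun x => ?_⟩
  have hx : L.symm x = toComplex x := by rw [← hL (L.symm x), L.apply_symm_apply]
  simp [hL, hx, rotation_apply, add_comm]

theorem cEdge_motion {f g : ℤ → Plane} {μ τ : ℂ}
    (h : ∀ n, toComplex (g n) = μ * toComplex (f n) + τ) (n : ℤ) :
    cEdge g n = μ * cEdge f n := by
  rw [cEdge, cEdge, h, h]; ring

theorem cTangent_motion {f g : ℤ → Plane} {μ τ : ℂ}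
    (h : ∀ n, toComplex (g n) = μ * toComplex (f n) + τ) (n : ℤ) :
    cTangent g n = μ * cTangent f n := by
  rw [cTangent, cTangent, cEdge_motion h, cEdge_motion h, mul_inv, mul_inv, ← mul_add, mul_inv,
    inv_inv]
  ring

theorem cMKdV_motion {f g : ℤ → Plane} {μ τ : ℂ} (hμ : μ ≠ 0)
    (h : ∀ n, toComplex (g n) = μ * toComplex (f n) + τ) (n : ℤ) :
    cMKdV g n = μ * cMKdV f n := by
  have hV : ∀ m, cVertex g m = cVertex f m := by
    intro m
    rw [cVertex, cVertex, cEdge_motion h, cTangent_motion h, mul_div_mul_left _ _ hμ]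
  rw [cMKdV, cMKdV, hV, hV, hV, cTangent_motion h]
  ring

/-- Both flows are equivariant under z ↦ μz + τ, so the velocity required at time t is the initial
one rotated by μ t. -/
theorem isInvariantUnderFlow_of_motions {f : ℤ → Plane} {a b : ℝ} (μ : ℝ → Circle) (τ : ℝ → ℂ)
    (hμ : ∀ s t, μ (s + t) = μ s * μ t) (hτ : ∀ s t, τ (s + t) = μ s * τ t + τ s)
    (h : ∀ t n, HasDerivAt (fun s => (μ s : ℂ) * toComplex (f n) + τ s)
      (μ t * (a * cMKdV f n + b * cTangent f n)) t) :
    IsInvariantUnderFlow (fun g n => a • mKdVFlow g n + b • tangentFlow g n) f := by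
  choose φ hφ using fun t => exists_motion (μ t) (τ t)
  refine ⟨φ, fun s t x => toComplex_injective ?_, fun t n => ?_⟩
  · rw [hφ, hφ, hφ, hμ, hτ, Circle.coe_mul]; ring
  · have hg : ∀ m, toComplex (φ t (f m)) = μ t * toComplex (f m) + τ t := fun m => hφ t _
    simp only [flow_eq]
    rw [cMKdV_motion (Circle.coe_ne_zero _) hg, cTangent_motion hg]
    have := oddQuatCLM.hasFDerivAt.comp_hasDerivAt t (h t n)
    refine (this.congr_deriv ?_).congr_of_eventuallyEq (Filter.Eventually.of_forall fun s => ?_)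
    · rw [oddQuatCLM_apply]
      congr 1
      ring
    · rw [Function.comp_apply, oddQuatCLM_apply]
      exact congrArg oddQuat (hφ s (f n))

/-- A curve is invariant under a flow whose vector field restricts to an infinitesimal motion. -/
theorem isInvariantUnderFlow_of_infinitesimal {f : ℤ → Plane} {a b ω : ℝ} {τ : ℂ}
    (h : ∀ n, (a * cMKdV f n + b * cTangent f n : ℂ) = I * ω * toComplex (f n) + τ) :
    IsInvariantUnderFlow (fun g n => a • mKdVFlow g n + b • tangentFlow g n) f := by
  rcases eq_or_ne ω 0 with rfl | hω
  · refine isInvariantUnderFlow_of_motions (fun _ => 1) (fun t => t * τ) (by simp)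
      (fun s t => by push_cast; simp; ring) fun t n => ?_
    rw [h]
    have := ((Complex.ofRealCLM.hasDerivAt (x := t)).mul_const τ).const_add
      (toComplex (f n))
    simpa using this
  · have hω' : (ω : ℂ) ≠ 0 := by exact_mod_cast hω
    have hexp : ∀ t : ℝ, HasDerivAt (fun s : ℝ => (Circle.exp (ω * s) : ℂ))
        (Circle.exp (ω * t) * (I * ω)) t := by
      intro t
      have h1 : HasDerivAt (fun s : ℝ => ((ω * s : ℝ) : ℂ) * I) (ω * I) t := by
        have := ((Complex.ofRealCLM.hasDerivAt (x := t)).const_mul (ω : ℂ)).mul_const I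
        simpa using this
      have := h1.cexp
      simp only [Circle.coe_exp]
      exact this.congr_deriv (by ring)
    -- Rotation about the zero -τ/(iω) of the infinitesimal motion.
    refine isInvariantUnderFlow_of_motions (fun t => Circle.exp (ω * t))
      (fun t => (Circle.exp (ω * t) - 1) * (τ / (I * ω)))
      (fun s t => by rw [mul_add, Circle.exp_add])
      (fun s t => by rw [mul_add, Circle.exp_add, Circle.coe_mul]; ring) fun t n => ?_
    have := ((hexp t).mul_const (toComplex (f n))).add
      (((hexp t).sub_const 1).mul_const (τ / (I * ω)))
    rw [h]
    refine this.congr_deriv ?_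
    field_simp [Complex.I_ne_zero]

/-! ### Bäcklund transformations in complex coordinates -/

theorem reflection_mk'_orthogonal_singleton (p v x : Plane) (hv : v ≠ 0) :
    EuclideanGeometry.reflection (AffineSubspace.mk' p (ℝ ∙ v)ᗮ) x =
      x - (2 * inner ℝ v (x - p) / ‖v‖ ^ 2) • v := by
  have hv' : ‖v‖ ^ 2 ≠ 0 := by positivity
  set t : ℝ := inner ℝ v (x - p) / ‖v‖ ^ 2 with ht
  have hx : x = t • v +ᵥ (x - t • v) := by simp
  have hmem : x - t • v ∈ AffineSubspace.mk' p (ℝ ∙ v)ᗮ := by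
    rw [AffineSubspace.mem_mk', Submodule.mem_orthogonal_singleton_iff_inner_right, vsub_eq_sub,
      sub_right_comm, inner_sub_right, inner_smul_right, real_inner_self_eq_norm_sq, ht]
    field_simp
    ring
  have hdir : t • v ∈ (AffineSubspace.mk' p (ℝ ∙ v)ᗮ).directionᗮ := by
    rw [AffineSubspace.direction_mk', Submodule.orthogonal_orthogonal]
    exact Submodule.smul_mem _ _ (Submodule.mem_span_singleton_self v)
  conv_lhs => rw [hx]
  rw [EuclideanGeometry.reflection_orthogonal_vadd hmem hdir, vadd_eq_add, ht]
  module

theorem toComplex_reflection (p v x : Plane) (hv : v ≠ 0) :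
    toComplex (EuclideanGeometry.reflection (AffineSubspace.mk' p (ℝ ∙ v)ᗮ) x) =
      toComplex x - toComplex (x - p) -
        toComplex v * conj (toComplex (x - p)) / conj (toComplex v) := by
  have hv' : toComplex v ≠ 0 := fun h => hv (toComplex_injective (by
    rw [h, ← sub_self v, toComplex_sub, sub_self]))
  have hc : conj (toComplex v) ≠ 0 := (map_ne_zero _).2 hv'
  have hn : ((‖v‖ ^ 2 : ℝ) : ℂ) = toComplex v * conj (toComplex v) := by
    rw [← real_inner_self_eq_norm_sq, inner_eq_re_mul_conj, Complex.mul_conj, Complex.ofReal_re]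
  have hi : ((2 * inner ℝ v (x - p) : ℝ) : ℂ) = toComplex v * conj (toComplex (x - p)) +
      conj (toComplex v) * toComplex (x - p) := by
    rw [inner_eq_re_mul_conj, Complex.ofReal_mul, Complex.re_eq_add_conj]
    simp
    ring
  rw [reflection_mk'_orthogonal_singleton p v x hv, toComplex_sub, toComplex_smul,
    Complex.ofReal_div, hn, hi]
  field_simp
  ring

/-- The mirror is orthogonal to b - d, so the linear part of the reflection is z ↦ -(b - d) z̄ /
conj (b - d), and it sends d - a to b - c. -/
theorem IsDarbouxButterfly.butterfly_eq {a b c d : Plane} (h : IsDarbouxButterfly a b c d) :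
    (toComplex c - toComplex b) * conj (toComplex b - toComplex d) =
      (toComplex b - toComplex d) * conj (toComplex d - toComplex a) := by
  obtain ⟨-, -, p, v, hv, ha, hb⟩ := h
  have hv' : toComplex v ≠ 0 := fun h => hv (toComplex_injective (by
    rw [h, ← sub_self v, toComplex_sub, sub_self]))
  have hc : conj (toComplex v) ≠ 0 := (map_ne_zero _).2 hv'
  rw [← ha, ← hb, toComplex_reflection p v a hv, toComplex_reflection p v b hv]
  simp only [toComplex_sub, map_sub, map_div₀, map_mul, Complex.conj_conj]
  field_simp
  ring

theorem isDarbouxButterfly_of_eq {a b c d : Plane} (hac : a ≠ c) (hbd : b ≠ d)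
    (hn : ‖toComplex c - toComplex b‖ = ‖toComplex d - toComplex a‖)
    (h : (toComplex c - toComplex b) * conj (toComplex b - toComplex d) =
      (toComplex b - toComplex d) * conj (toComplex d - toComplex a)) :
    IsDarbouxButterfly a b c d := by
  have hv : c - a ≠ 0 := sub_ne_zero.2 hac.symm
  have hv' : toComplex c - toComplex a ≠ 0 := sub_ne_zero.2 (toComplex_injective.ne hac.symm)
  have hc : conj (toComplex c) - conj (toComplex a) ≠ 0 := by
    rw [← map_sub]; exact (map_ne_zero _).2 hv'
  have hn' : (toComplex c - toComplex b) * conj (toComplex c - toComplex b) =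
      (toComplex d - toComplex a) * conj (toComplex d - toComplex a) := by
    rw [Complex.mul_conj', Complex.mul_conj', hn]
  -- The mirror is the perpendicular bisector of a and c.
  refine ⟨hac, hbd, (1 / 2 : ℝ) • (a + c), c - a, hv, toComplex_injective ?_,
    toComplex_injective ?_⟩
  · rw [toComplex_reflection _ _ _ hv]
    simp only [toComplex_sub, toComplex_add, toComplex_smul, map_sub, map_add, map_mul,
      Complex.conj_ofReal]
    push_cast
    field_simp
    ring
  · rw [toComplex_reflection _ _ _ hv]
    simp only [map_sub] at h hn'
    have h' := congrArg conj h
    simp only [map_sub, map_mul, Complex.conj_conj] at h'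
    simp only [toComplex_sub, toComplex_add, toComplex_smul, map_sub, map_add, map_mul,
      Complex.conj_ofReal]
    push_cast
    field_simp
    linear_combination 2 * h' + 2 * hn'

theorem IsBacklund.butterfly_eq {f g : ℤ → Plane} (h : IsBacklund f g) (n : ℤ) :
    (toComplex (g (n + 1)) - toComplex (f (n + 1))) *
        conj (cEdge f n - (toComplex (g n) - toComplex (f n))) =
      (cEdge f n - (toComplex (g n) - toComplex (f n))) *
        conj (toComplex (g n) - toComplex (f n)) := by
  have := (h n).butterfly_eq
  rw [cEdge, sub_sub_sub_cancel_right]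
  exact this

/-- A field of transformation vectors of constant length, different from the edge length, that
satisfies the evolution equation of the butterflies gives a Bäcklund transformation. -/
theorem backlund_of_field {η ℓ : ℝ} {f : ℤ → Plane} (hf : IsArcLengthCurve η f) {v : ℤ → ℂ}
    (hv : ∀ n, ‖v n‖ = ℓ) (hℓ : ℓ ≠ η)
    (hev : ∀ n, v (n + 1) * conj (cEdge f n - v n) = (cEdge f n - v n) * conj (v n)) :
    IsArcLengthCurve η (fun n => ofComplex (toComplex (f n) + v n)) ∧
      IsBacklund f (fun n => ofComplex (toComplex (f n) + v n)) := by
  have hne : ∀ m n, ‖v m‖ ≠ ‖cEdge f n‖ := fun m n => by rwa [hv, hf.norm_cEdge]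
  have hsub : ∀ n, cEdge f n - v n ≠ 0 := fun n h => hne n n (by rw [sub_eq_zero.1 h])
  have hadd : ∀ n, cEdge f n + v (n + 1) ≠ 0 := fun n h =>
    hne (n + 1) n (by rw [eq_neg_of_add_eq_zero_left h, norm_neg])
  have hvv : ∀ n, v n * conj (v n) = (ℓ : ℂ) ^ 2 := fun n => by rw [Complex.mul_conj', hv]
  have hbf : IsBacklund f (fun n => ofComplex (toComplex (f n) + v n)) := by
    intro n
    apply isDarbouxButterfly_of_eq
    · intro h
      have := congrArg toComplex h
      rw [toComplex_ofComplex] at this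
      apply hadd n
      rw [cEdge]
      linear_combination -this
    · intro h
      have := congrArg toComplex h
      rw [toComplex_ofComplex] at this
      apply hsub n
      rw [cEdge]
      linear_combination this
    · simp only [toComplex_ofComplex, add_sub_cancel_left, hv]
    · simp only [toComplex_ofComplex, add_sub_cancel_left, ← sub_sub]
      exact hev n
  have hdist : ∀ n, dist (ofComplex (toComplex (f n) + v n))
      (ofComplex (toComplex (f (n + 1)) + v (n + 1))) = η := by
    intro n
    obtain ⟨-, -, p, w, -, h1, h2⟩ := hbf n
    have h := hf.dist_eq n
    rw [← AffineIsometryEquiv.dist_map (EuclideanGeometry.reflection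
      (AffineSubspace.mk' p (ℝ ∙ w)ᗮ)), h1, h2, dist_comm] at h
    exact h
  -- If the new curve folds back at n, its two edges there are -t and t. Eliminating t from the two
  -- butterfly equations leaves (ℓ² - η²)(u_{n-1} + u_n) = 0, and neither factor vanishes.
  have hreg : ∀ n, toComplex (f (n - 1)) + v (n - 1) ≠ toComplex (f (n + 1)) + v (n + 1) := by
    intro n h
    have hev0 := hev (n - 1)
    have hs := hf.cEdge_add_ne_zero n
    have ht : cEdge f (n - 1) + v n - v (n - 1) = -(cEdge f n + v (n + 1) - v n) := by
      rw [cEdge, cEdge, sub_add_cancel]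
      linear_combination -h
    rw [sub_add_cancel] at hev0
    have hev1 := hev n
    have htt : (cEdge f n + v (n + 1) - v n) * conj (cEdge f n + v (n + 1) - v n) =
        (η : ℂ) ^ 2 := by
      have hd := hdist n
      rw [dist_eq_norm_toComplex, toComplex_ofComplex, toComplex_ofComplex] at hd
      rw [← hd, ← Complex.mul_conj', cEdge]
      ring_nf
    set t := cEdge f n + v (n + 1) - v n with ht'
    set a := cEdge f (n - 1)
    set b := cEdge f n
    set x := v (n - 1)
    set y := v n
    set z := v (n + 1)
    have htc := congrArg conj ht
    have hE1 : t * conj y = z * conj b := by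
      rw [map_sub] at hev1
      linear_combination -hev1 + conj y * ht'
    have hE0 : -t * conj x = y * conj a := by
      rw [map_sub] at hev0
      linear_combination -hev0 - conj x * ht
    have hE0' := congrArg conj hE0
    simp only [map_sub, map_add, map_mul, map_neg, Complex.conj_conj] at htc hE0'
    have h4 : z * conj b * a = -η ^ 2 * x := by
      linear_combination -a * hE1 - t * hE0' - x * htt
    have h5 : z * conj a + z * conj b + b * conj a = -η ^ 2 := by
      linear_combination -hE1 - hE0 + t * htc - htt - conj a * ht'
    have h5' := congrArg conj h5
    simp only [map_add, map_mul, map_neg, map_pow, Complex.conj_conj, Complex.conj_ofReal] at h5'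
    have h6 : ((ℓ : ℂ) ^ 2 - η ^ 2) * (a + b) = 0 := by
      linear_combination z * h5' - h4 - (a + b) * hvv (n + 1) + η ^ 2 * (ht' - ht)
    rcases mul_eq_zero.1 h6 with h7 | h7
    · apply hℓ
      have h8 : ℓ ^ 2 = η ^ 2 := by exact_mod_cast sub_eq_zero.1 h7
      exact (sq_eq_sq₀ (by rw [← hv 0]; positivity) hf.pos.le).1 h8
    · exact hs h7
  exact ⟨⟨hf.pos, hdist, fun n h => hreg n (by simpa using congrArg toComplex h)⟩, hbf⟩

/-! ### Intertwining polynomials -/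

theorem eq_of_forall_succ_eq {α : Type*} {s : ℤ → α} (h : ∀ n, s (n + 1) = s n) (m n : ℤ) :
    s m = s n := by
  have h0 : ∀ k, s k = s 0 := fun k => by
    induction k with
    | zero => rfl
    | succ k ih => rw [h, ih]
    | pred k ih => rw [← ih, ← h, sub_add_cancel]
  rw [h0, h0 n]

/-- The polynomial `𝒫 = E + λ c + λ² γ + λ³ w`, with `E, γ` in `span {𝟏, 𝐤}` and `c, w` in
`span {𝐢, 𝐣}`, satisfies `𝒫_{n+1} (1 + λ u_n) = (1 + λ û_n) 𝒫_n`. -/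
structure Intertwines (E : ℂ) (u û c γ w : ℤ → ℂ) : Prop where
  one (n : ℤ) : c (n + 1) + E * u n = c n + û n * conj E
  two (n : ℤ) : γ (n + 1) - c (n + 1) * conj (u n) = γ n - û n * conj (c n)
  three (n : ℤ) : w (n + 1) + γ (n + 1) * u n = w n + û n * conj (γ n)
  four (n : ℤ) : w (n + 1) * conj (u n) = û n * conj (w n)

/-- Right multiplication of the intertwiner by 1 + λv_n. The hypotheses on v say that 1 + λv itself
intertwines u with u'. -/
theorem Intertwines.comp {E : ℂ} {u u' û c γ v : ℤ → ℂ} (h : Intertwines E u' û c γ 0)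
    (hu : ∀ n, u' n = u n + v (n + 1) - v n)
    (hv : ∀ n, v (n + 1) * conj (u n - v n) = (u n - v n) * conj (v n)) :
    Intertwines E u û (fun n => c n + E * v n) (fun n => γ n - c n * conj (v n))
      (fun n => γ n * v n) := by
  have hb : ∀ n, u' n * conj (v n) = v (n + 1) * conj (u n) := by
    intro n
    have := hv n
    rw [map_sub] at this
    rw [hu]
    linear_combination -this
  have hb' : ∀ n, conj (u' n) * v n = conj (v (n + 1)) * u n := by
    intro n
    simpa using congrArg conj (hb n)
  have h3 : ∀ n, γ (n + 1) * u' n = û n * conj (γ n) := fun n => by simpa using h.three n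
  refine ⟨fun n => ?_, fun n => ?_, fun n => ?_, fun n => ?_⟩
  · linear_combination h.one n - E * hu n
  · have huc := congrArg conj (hu n)
    simp only [map_sub, map_add, map_mul] at huc ⊢
    linear_combination h.two n + E * hb n + c (n + 1) * huc - conj (v n) * h.one n
  · simp only [map_sub, map_mul, Complex.conj_conj]
    linear_combination h3 n - γ (n + 1) * hu n + v n * h.two n + c (n + 1) * hb' n
  · simp only [map_mul]
    linear_combination conj (v n) * h3 n - γ (n + 1) * hb n

/-! ### Closed intertwiners in moving coordinates -/

/-- The equations satisfied by the coordinates of a polynomial that intertwines a curve with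
itself. The odd coefficients at `n` are `u_n (X_n + i Y_n)` and `u_n (Z_n + i V_n)`, the imaginary
parts of the even coefficients are `ε` and `y_n`. -/
structure ClosedCoordinates (η ε : ℝ) (K X Y Z V y : ℤ → ℝ) : Prop where
  x_succ (n : ℤ) : X (n + 1) - K (n + 1) * Y (n + 1) = X n + K (n + 1) * (Y n - 2 * ε)
  y_succ (n : ℤ) : Y (n + 1) + K (n + 1) * X (n + 1) = Y n - 2 * ε - K (n + 1) * X n
  z_succ (n : ℤ) : Z (n + 1) - K (n + 1) * V (n + 1) = Z n - K (n + 1) * V n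
  v_succ (n : ℤ) : V (n + 1) + K (n + 1) * Z (n + 1) = -V n - K (n + 1) * Z n
  sub_eq (n : ℤ) : y (n + 1) = y n + 2 * η ^ 2 * (Y n - ε)
  add_eq (n : ℤ) : y n + y (n + 1) = 2 * V n

theorem mul_rotation_iff {u u' : ℂ} {K a b a' b' : ℝ}
    (h : (1 + I * K) * u = (1 - I * K) * u') (hu : u ≠ 0) :
    u' * (a' + I * b') = u * (a + I * b) ↔
      a' - K * b' = a + K * b ∧ b' + K * a' = b - K * a := by
  have hK : (1 - I * K : ℂ) ≠ 0 := fun h0 => by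
    have := congrArg Complex.re h0
    simp at this
  have hex : u' * (a' + I * b') = u * (a + I * b) ↔
      (1 + I * K) * (a' + I * b') = (1 - I * K) * (a + I * b) := by
    constructor <;> intro h1
    · refine mul_left_cancel₀ hu ?_
      linear_combination (1 - I * K) * h1 + (a' + I * b') * h
    · refine mul_left_cancel₀ hK ?_
      linear_combination u * h1 - (a' + I * b') * h
  rw [hex, Complex.ext_iff]
  simp only [Complex.mul_re, Complex.mul_im, Complex.add_re, Complex.add_im, Complex.sub_re,
    Complex.sub_im, Complex.one_re, Complex.one_im, Complex.I_re, Complex.I_im,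
    Complex.ofReal_re, Complex.ofReal_im]
  constructor <;> rintro ⟨h1, h2⟩ <;> constructor <;> linarith

/-- The real constants ρ and ρ' are central and drop out of all equations. They remain free, which
later allows the zeros of the determinant to be placed. -/
theorem intertwines_iff_closedCoordinates {η ρ ρ' ε : ℝ} {K X Y Z V y : ℤ → ℝ} {u : ℤ → ℂ}
    (hη : η ≠ 0) (hu : ∀ n, u n * conj (u n) = (η : ℂ) ^ 2)
    (hK : ∀ n, (1 + I * K n) * u (n - 1) = (1 - I * K n) * u n) :
    Intertwines (ρ + I * ε) u u (fun n => u n * (X n + I * Y n)) (fun n => ρ' + I * y n)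
        (fun n => u n * (Z n + I * V n)) ↔ ClosedCoordinates η ε K X Y Z V y := by
  have hη' : (η : ℂ) ^ 2 ≠ 0 := by exact_mod_cast pow_ne_zero 2 hη
  have hu0 : ∀ n, u n ≠ 0 := fun n h => hη' (by rw [← hu n, h, zero_mul])
  have hc0 : ∀ n, conj (u n) ≠ 0 := fun n => (map_ne_zero _).2 (hu0 n)
  have hrot : ∀ n, (1 + I * K (n + 1)) * u n = (1 - I * K (n + 1)) * u (n + 1) := fun n => by
    simpa using hK (n + 1)
  have one : ∀ n, u (n + 1) * (X (n + 1) + I * Y (n + 1)) + (ρ + I * ε) * u n =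
      u n * (X n + I * Y n) + u n * conj (ρ + I * ε : ℂ) ↔
      X (n + 1) - K (n + 1) * Y (n + 1) = X n + K (n + 1) * (Y n - 2 * ε) ∧
        Y (n + 1) + K (n + 1) * X (n + 1) = Y n - 2 * ε - K (n + 1) * X n := by
    intro n
    rw [← mul_rotation_iff (hrot n) (hu0 n)]
    simp only [map_add, map_mul, Complex.conj_I, Complex.conj_ofReal]
    push_cast
    constructor <;> intro h <;> linear_combination h
  have four : ∀ n, u (n + 1) * (Z (n + 1) + I * V (n + 1)) * conj (u n) =
      u n * conj (u n * (Z n + I * V n)) ↔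
      Z (n + 1) - K (n + 1) * V (n + 1) = Z n - K (n + 1) * V n ∧
        V (n + 1) + K (n + 1) * Z (n + 1) = -V n - K (n + 1) * Z n := by
    intro n
    have := mul_rotation_iff (a := Z n) (b := -V n) (a' := Z (n + 1)) (b' := V (n + 1))
      (hrot n) (hu0 n)
    rw [mul_neg, ← sub_eq_add_neg] at this
    rw [← this]
    simp only [map_add, map_mul, Complex.conj_I, Complex.conj_ofReal]
    push_cast
    constructor <;> intro h
    · refine mul_right_cancel₀ (hc0 n) ?_
      linear_combination h
    · linear_combination conj (u n) * h
  -- The λ-equation eliminates the shifted odd coefficient from the λ²-equation; `three` uses the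
  -- λ⁴-equation in the same way.
  have two : ∀ n, u (n + 1) * (X (n + 1) + I * Y (n + 1)) = u n * (X n + I * (Y n - 2 * ε)) →
      ((ρ' + I * y (n + 1) - u (n + 1) * (X (n + 1) + I * Y (n + 1)) * conj (u n) =
        ρ' + I * y n - u n * conj (u n * (X n + I * Y n)) : Prop) ↔
        y (n + 1) = y n + 2 * η ^ 2 * (Y n - ε)) := by
    intro n h
    rw [h, ← Complex.ofReal_inj]
    simp only [map_add, map_mul, Complex.conj_I, Complex.conj_ofReal]
    push_cast
    constructor <;> intro h1
    · refine mul_left_cancel₀ Complex.I_ne_zero ?_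
      linear_combination h1 + 2 * I * (Y n - ε) * hu n
    · linear_combination I * h1 - 2 * I * (Y n - ε) * hu n
  have three : ∀ n, u (n + 1) * (Z (n + 1) + I * V (n + 1)) = u n * (Z n - I * V n) →
      ((u (n + 1) * (Z (n + 1) + I * V (n + 1)) + (ρ' + I * y (n + 1)) * u n =
        u n * (Z n + I * V n) + u n * conj (ρ' + I * y n : ℂ) : Prop) ↔
        y n + y (n + 1) = 2 * V n) := by
    intro n h
    rw [h, ← Complex.ofReal_inj]
    simp only [map_add, map_mul, Complex.conj_I, Complex.conj_ofReal]
    push_cast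
    constructor <;> intro h1
    · refine mul_left_cancel₀ (mul_ne_zero Complex.I_ne_zero (hu0 n)) ?_
      linear_combination h1
    · linear_combination I * u n * h1
  have hc : ∀ n, (X (n + 1) - K (n + 1) * Y (n + 1) = X n + K (n + 1) * (Y n - 2 * ε) ∧
        Y (n + 1) + K (n + 1) * X (n + 1) = Y n - 2 * ε - K (n + 1) * X n) →
      u (n + 1) * (X (n + 1) + I * Y (n + 1)) = u n * (X n + I * (Y n - 2 * ε)) := by
    intro n h
    have := (mul_rotation_iff (hrot n) (hu0 n)).2 h
    push_cast at this
    exact this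
  have hw : ∀ n, (Z (n + 1) - K (n + 1) * V (n + 1) = Z n - K (n + 1) * V n ∧
        V (n + 1) + K (n + 1) * Z (n + 1) = -V n - K (n + 1) * Z n) →
      u (n + 1) * (Z (n + 1) + I * V (n + 1)) = u n * (Z n - I * V n) := by
    intro n h
    rw [← four] at h
    simp only [map_add, map_mul, Complex.conj_I, Complex.conj_ofReal] at h
    refine mul_right_cancel₀ (hc0 n) ?_
    linear_combination h
  constructor
  · intro h
    have h1 := fun n => (one n).1 (h.one n)
    have h4 := fun n => (four n).1 (h.four n)
    exact ⟨fun n => (h1 n).1, fun n => (h1 n).2, fun n => (h4 n).1, fun n => (h4 n).2,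
      fun n => (two n (hc n (h1 n))).1 (h.two n), fun n => (three n (hw n (h4 n))).1 (h.three n)⟩
  · intro h
    have h1 := fun n => And.intro (h.x_succ n) (h.y_succ n)
    have h4 := fun n => And.intro (h.z_succ n) (h.v_succ n)
    exact ⟨fun n => (one n).2 (h1 n), fun n => (two n (hc n (h1 n))).2 (h.sub_eq n),
      fun n => (three n (hw n (h4 n))).2 (h.add_eq n), fun n => (four n).2 (h4 n)⟩

namespace ClosedCoordinates

variable {η ε : ℝ} {K X Y Z V y : ℤ → ℝ}

/-- At λ = i/η, the kernel of 1 + λu_n and the image of 1 + λu_{n-1} are invariant lines of 𝒫_n, so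
its trace-free part is known up to a scalar. In coordinates, V is expressed through y_n and through
y_{n+1}; comparing the equations for (Z, V) with η² times those for (X, Y) then shows that Z - η²X
is the constant β. -/
theorem exists_beta (h : ClosedCoordinates η ε K X Y Z V y) :
    ∃ β, ∀ n, Z n = η ^ 2 * X n + β ∧ y n = η ^ 2 * ε - β * K n ∧
      V n = η ^ 2 * Y n - β * K n := by
  have hV : ∀ n, V n = y n + η ^ 2 * (Y n - ε) := fun n => by
    linarith [h.sub_eq n, h.add_eq n]
  have hV' : ∀ n, V n = y (n + 1) - η ^ 2 * (Y n - ε) := fun n => by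
    linarith [h.sub_eq n, h.add_eq n]
  have hs : ∀ n, Z (n + 1) - η ^ 2 * X (n + 1) = Z n - η ^ 2 * X n := by
    intro n
    linear_combination h.z_succ n - η ^ 2 * h.x_succ n + K (n + 1) * (hV (n + 1) - hV' n)
  have hy : ∀ n, y n = η ^ 2 * ε - (Z 0 - η ^ 2 * X 0) * K n := by
    intro n
    obtain ⟨m, rfl⟩ : ∃ m, n = m + 1 := ⟨n - 1, by ring⟩
    rw [eq_of_forall_succ_eq (s := fun n => Z n - η ^ 2 * X n) hs 0 (m + 1)]
    linear_combination (h.v_succ m - η ^ 2 * h.y_succ m - hV (m + 1) - hV' m + K (m + 1) * hs m) / 2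
  refine ⟨Z 0 - η ^ 2 * X 0, fun n => ⟨?_, hy n, by linear_combination hV n + hy n⟩⟩
  rw [eq_of_forall_succ_eq (s := fun n => Z n - η ^ 2 * X n) hs 0 n]
  ring

theorem normSq_odd_succ {K X Y X' Y' : ℝ} (h1 : X' - K * Y' = X + K * Y)
    (h2 : Y' + K * X' = Y - K * X) : X' ^ 2 + Y' ^ 2 = X ^ 2 + Y ^ 2 := by
  have hK : (1 + K ^ 2) ≠ 0 := by positivity
  refine mul_left_cancel₀ hK ?_
  linear_combination (X' - K * Y' + X + K * Y) * h1 + (Y' + K * X' + Y - K * X) * h2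

/-- Conjugation by 1 + λu_n preserves the determinant of the trace-free part; this is its
λ²-coefficient. -/
theorem theta_two (h : ClosedCoordinates η ε K X Y Z V y) (m n : ℤ) :
    2 * ε * y m + η ^ 2 * (X m ^ 2 + Y m ^ 2) = 2 * ε * y n + η ^ 2 * (X n ^ 2 + Y n ^ 2) := by
  refine eq_of_forall_succ_eq (s := fun n => 2 * ε * y n + η ^ 2 * (X n ^ 2 + Y n ^ 2))
    (fun n => ?_) m n
  linear_combination η ^ 2 * normSq_odd_succ (h.x_succ n) (h.y_succ n) + 2 * ε * h.sub_eq n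

theorem theta_six (h : ClosedCoordinates η ε K X Y Z V y) (m n : ℤ) :
    η ^ 2 * (Z m ^ 2 + V m ^ 2) = η ^ 2 * (Z n ^ 2 + V n ^ 2) := by
  refine eq_of_forall_succ_eq (s := fun n => η ^ 2 * (Z n ^ 2 + V n ^ 2)) (fun n => ?_) m n
  have h1 := h.z_succ n
  rw [sub_eq_add_neg (Z n), ← mul_neg] at h1
  linear_combination η ^ 2 * normSq_odd_succ h1 (h.v_succ n)

theorem theta_four (h : ClosedCoordinates η ε K X Y Z V y) (hη : η ≠ 0) (m n : ℤ) :
    y m ^ 2 + 2 * η ^ 2 * (X m * Z m + Y m * V m) =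
      y n ^ 2 + 2 * η ^ 2 * (X n * Z n + Y n * V n) := by
  obtain ⟨β, hβ⟩ := h.exists_beta
  -- The determinant takes the value -β²/η⁴ at λ² = -1/η². This linear relation determines θ₄ from
  -- θ₀, θ₂, θ₆ and β.
  have hdet : ∀ k, y k ^ 2 + 2 * η ^ 2 * (X k * Z k + Y k * V k) = -β ^ 2 - η ^ 4 * ε ^ 2 +
      η ^ 2 * (2 * ε * y k + η ^ 2 * (X k ^ 2 + Y k ^ 2)) + (Z k ^ 2 + V k ^ 2) := by
    intro k
    obtain ⟨hZ, hy, hV⟩ := hβ k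
    rw [hZ, hy, hV]
    ring
  have h6 := mul_left_cancel₀ (pow_ne_zero 2 hη) (h.theta_six m n)
  rw [hdet, hdet, h.theta_two m n, h6]

/-- The first odd coefficient is determined by the curvature, the `θ_j` and `β`. -/
theorem coordinates_eq (h : ClosedCoordinates η ε K X Y Z V y) (hη : η ≠ 0) {β : ℝ} (hβ : β ≠ 0)
    (hZ : ∀ n, Z n = η ^ 2 * X n + β) (hy : ∀ n, y n = η ^ 2 * ε - β * K n)
    (hV : ∀ n, V n = η ^ 2 * Y n - β * K n) (n : ℤ) {b s t : ℝ}
    (hb : b = 1 / (2 * β * η ^ 4) * (η ^ 2 * (Z n ^ 2 + V n ^ 2) -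
      η ^ 4 * (2 * ε * y n + η ^ 2 * (X n ^ 2 + Y n ^ 2)) + 2 * η ^ 6 * ε ^ 2))
    (hs : s = -β / (2 * η ^ 2) * (1 + K n * (K (n - 1) + K (n + 1)) / 2) + b)
    (ht : t = -β / (2 * η ^ 2) * ((K (n + 1) - K (n - 1)) / 2)) :
    X n = s + K n * t ∧ Y n = t - K n * s := by
  -- The terms X² + Y² cancel in θ₆ - η⁴θ₂ and 2η⁶θ₀ removes ε², so b becomes linear in X and Y.
  have hb' : b = X n - K n * Y n + β / (2 * η ^ 2) * (1 + K n ^ 2) + ε * K n := by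
    rw [hb, hZ, hV, hy]
    field_simp
    ring
  have hY : Y n = ε - β / (2 * η ^ 2) * (K (n + 1) - K n) := by
    have h1 := h.sub_eq n
    rw [hy, hy] at h1
    field_simp
    linear_combination -h1
  have hY' : Y (n - 1) = ε - β / (2 * η ^ 2) * (K n - K (n - 1)) := by
    have h1 := h.sub_eq (n - 1)
    rw [hy, hy, sub_add_cancel] at h1
    field_simp
    linear_combination -h1
  have hx := h.x_succ (n - 1)
  have hyy := h.y_succ (n - 1)
  rw [sub_add_cancel] at hx hyy
  -- Both goals together say X + iY = (s + it)(1 - iK), that is, the coefficient is (s + it) T_n.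
  constructor
  · linear_combination -hs - K n * ht - hb' + K n * hY
  · linear_combination -ht + K n * hs + K n * hb' + (hyy + K n * hx + hY + hY') / 2 +
      K n ^ 2 / 2 * (hY' - hY)

/-- Constant y forces Y = ε, then X is constant and K X = -ε. Either X ≠ 0 and K is constant, or
everything vanishes. -/
theorem const_of_beta_eq_zero (h : ClosedCoordinates η ε K X Y Z V y)
    (hη : η ≠ 0)
    (hy : ∀ n, y n = η ^ 2 * ε) :
    (∀ m n, K m = K n) ∨ ε = 0 ∧ ∀ n, X n = 0 ∧ Y n = 0 := by
  have hY : ∀ n, Y n = ε := fun n => by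
    have h1 := h.sub_eq n
    rw [hy, hy] at h1
    have h2 : η ^ 2 * (Y n - ε) = 0 := by linarith
    have := (mul_eq_zero.1 h2).resolve_left (pow_ne_zero 2 hη)
    linarith
  have hXs : ∀ n, X (n + 1) = X n := fun n => by
    have := h.x_succ n
    rw [hY, hY] at this
    linarith
  have hXK : ∀ n, K n * X n = -ε := fun n => by
    have := h.y_succ (n - 1)
    have h1 := hXs (n - 1)
    rw [sub_add_cancel] at this h1
    rw [hY, hY, ← h1] at this
    linarith
  rcases eq_or_ne (X 0) 0 with h0 | h0
  · right
    have hX0 : ∀ n, X n = 0 := fun n => (eq_of_forall_succ_eq hXs n 0).trans h0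
    have hε : ε = 0 := by
      have := hXK 0
      rw [h0] at this
      linarith
    exact ⟨hε, fun n => ⟨hX0 n, by rw [hY, hε]⟩⟩
  · left
    intro m n
    have hm := hXK m
    have hn := hXK n
    rw [eq_of_forall_succ_eq hXs m 0] at hm
    rw [eq_of_forall_succ_eq hXs n 0] at hn
    exact mul_right_cancel₀ h0 (hm.trans hn.symm)

end ClosedCoordinates

/-! ### Factorization of intertwining polynomials -/

/-- The determinant of `E + λ c + λ² γ + λ³ w` at `λ² = t`. -/
def polyDet (E c γ w : ℂ) (t : ℝ) : ℂ :=
  (E + t * γ) * conj (E + t * γ) + t * ((c + t * w) * conj (c + t * w))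

/-- Multiplicativity of the determinant, with det(1 + λv) = 1 + λ²|v|². -/
theorem polyDet_comp (E c γ v : ℂ) (t : ℝ) :
    polyDet E (c + E * v) (γ - c * conj v) (γ * v) t =
      polyDet E c γ 0 t * (1 + t * (v * conj v)) := by
  simp only [polyDet, map_add, map_sub, map_mul, Complex.conj_conj, Complex.conj_ofReal, map_zero]
  ring

/-- A simple zero `λ² = x` of the determinant splits off a linear factor `1 + λ v` on the right. -/
theorem Intertwines.exists_factor {E : ℂ} {u û c γ w : ℤ → ℂ} (h : Intertwines E u û c γ w)
    {x : ℝ} (hA : ∀ n, E + x * γ n ≠ 0) (hx : ∀ n, polyDet E (c n) (γ n) (w n) x = 0) :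
    ∃ v c' γ' : ℤ → ℂ, (∀ n, x * (v n * conj (v n)) = -1) ∧
      (∀ n, v (n + 1) * conj (u n - v n) = (u n - v n) * conj (v n)) ∧
      (∀ n, c n = c' n + E * v n) ∧ (∀ n, γ n = γ' n - c' n * conj (v n)) ∧
      (∀ n, w n = γ' n * v n) ∧
      Intertwines E (fun n => u n + v (n + 1) - v n) û c' γ' 0 := by
  obtain ⟨v, hv⟩ : ∃ v : ℤ → ℂ, ∀ n, (E + x * γ n) * v n = c n + x * w n :=
    ⟨fun n => (c n + x * w n) / (E + x * γ n), fun n => mul_div_cancel₀ _ (hA n)⟩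
  have hxv : ∀ n, x * (v n * conj (v n)) = -1 := by
    intro n
    have hA' : conj (E + x * γ n) ≠ 0 := (map_ne_zero _).2 (hA n)
    have h1 := hx n
    rw [polyDet, ← hv n, map_mul] at h1
    refine mul_left_cancel₀ (mul_ne_zero (hA n) hA') ?_
    linear_combination h1
  have hx0 : (x : ℂ) ≠ 0 := fun h0 => by
    have := hxv 0
    rw [h0] at this
    simp at this
  have hc0 : ∀ n, conj (v n) ≠ 0 := fun n h0 => by
    have := hxv n
    rw [h0] at this
    simp at this
  have hev : ∀ n, v (n + 1) * conj (u n - v n) = (u n - v n) * conj (v n) := by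
    intro n
    have hvc := congrArg conj (hv n)
    simp only [map_add, map_mul, Complex.conj_ofReal] at hvc
    -- `e1` and `e2` are the even and odd parts of the intertwining relation at λ² = x. Together
    -- they say that 1 + λu_n maps the kernel of 1 + λv_n into that of 1 + λv_{n+1}, which is `e3`.
    have e1 : (E + x * γ (n + 1)) * (1 - x * v (n + 1) * conj (u n)) =
        E + x * γ n - x * û n * ((conj E + x * conj (γ n)) * conj (v n)) := by
      linear_combination x * h.two n - x ^ 2 * h.four n - x * conj (u n) * hv (n + 1) +
        x * û n * hvc
    have e2 : (E + x * γ (n + 1)) * (v (n + 1) + u n) =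
        (E + x * γ n) * v n + û n * (conj E + x * conj (γ n)) := by
      linear_combination h.one n + x * h.three n + hv (n + 1) - hv n
    have e3 : x * (v (n + 1) + u n) * conj (v n) = -1 + x * v (n + 1) * conj (u n) := by
      refine mul_left_cancel₀ (hA (n + 1)) ?_
      linear_combination x * conj (v n) * e2 + e1 + (E + x * γ n) * hxv n
    rw [map_sub]
    refine mul_left_cancel₀ hx0 ?_
    linear_combination -e3 + hxv n
  have hb : ∀ n, (u n + v (n + 1) - v n) * conj (v n) = v (n + 1) * conj (u n) := by
    intro n
    have := hev n
    rw [map_sub] at this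
    linear_combination -this
  -- Division by 1 + λv on the right leaves no remainder.
  have hw : ∀ n, w n = (γ n + (c n - E * v n) * conj (v n)) * v n := by
    intro n
    refine mul_left_cancel₀ hx0 ?_
    linear_combination -hv n - (c n - E * v n) * hxv n
  refine ⟨v, fun n => c n - E * v n, fun n => γ n + (c n - E * v n) * conj (v n), hxv, hev,
    fun n => by ring, fun n => by ring, hw, fun n => ?_, fun n => ?_, fun n => ?_, fun n => ?_⟩
  · linear_combination h.one n
  · simp only [map_sub, map_add, map_mul]
    linear_combination h.two n - E * hb n + conj (v n) * h.one n
  · have hwc := congrArg conj (hw n)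
    refine mul_right_cancel₀ (hc0 n) ?_
    simp only [map_add, map_sub, map_mul, Complex.conj_conj, Pi.zero_apply] at hwc ⊢
    linear_combination h.four n + (γ (n + 1) + (c (n + 1) - E * v (n + 1)) * conj (v (n + 1))) *
      hb n - conj (u n) * hw (n + 1) + û n * hwc
  · simp

theorem norm_of_mul_conj {x : ℝ} {v : ℂ} (h : x * (v * conj v) = -1) : ‖v‖ = √(-x⁻¹) := by
  rw [Complex.mul_conj'] at h
  have h1 : x * ‖v‖ ^ 2 = -1 := by exact_mod_cast h
  have hx : x ≠ 0 := fun h0 => by rw [h0] at h1; simp at h1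
  rw [← Real.sqrt_sq (norm_nonneg v)]
  congr 1
  field_simp
  linarith

/-- After splitting off a factor, a further zero of the determinant can be split off. -/
theorem polyDet_quotient {E c γ c' γ' w v : ℂ} {x t : ℝ} (hv : x * (v * conj v) = -1)
    (hc : c = c' + E * v) (hγ : γ = γ' - c' * conj v) (hw : w = γ' * v) (ht : t ≠ x) (ht0 : t ≠ 0)
    (hdet : polyDet E c γ w t = 0) (hA : E + t * γ ≠ 0) :
    polyDet E c' γ' 0 t = 0 ∧ E + t * γ' ≠ 0 := by
  have hx0 : (x : ℂ) ≠ 0 := fun h0 => by rw [h0] at hv; simp at hv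
  have h1 : polyDet E c' γ' 0 t = 0 := by
    rw [hc, hγ, hw, polyDet_comp] at hdet
    refine (mul_eq_zero.1 hdet).resolve_right fun h0 => ht ?_
    have : (t : ℂ) = x := by linear_combination t * hv - x * h0
    exact_mod_cast this
  -- If E + tγ' = 0, the vanishing determinant gives c' = 0, hence γ = γ', contrary to `hA`.
  refine ⟨h1, fun h2 => hA ?_⟩
  rw [polyDet, h2] at h1
  have ht0' : (t : ℂ) ≠ 0 := by exact_mod_cast ht0
  have hc' : c' = 0 := by simpa [ht0'] using h1
  rw [hγ, hc']
  linear_combination h2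

/-! ### Real zeros -/

theorem exists_cubic_neg (a b c : ℝ) {d : ℝ} (hd : 0 < d) (M : ℝ) :
    ∃ t < M, a + b * t + c * t ^ 2 + d * t ^ 3 < 0 := by
  set N := 1 + |M| + (|a| + |b| + |c|) / d with hN
  have hq : 0 ≤ (|a| + |b| + |c|) / d := by positivity
  have hN1 : 1 ≤ N := by linarith [abs_nonneg M]
  have hd1 : |a| + |b| + |c| < d * N := by
    have : d * ((|a| + |b| + |c|) / d) = |a| + |b| + |c| := by field_simp
    have h2 : 0 < d * (1 + |M|) := by positivity
    rw [hN, mul_add]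
    linarith
  refine ⟨-N, by linarith [neg_abs_le M], ?_⟩
  have h1 : (|a| + |b| + |c|) * N ^ 2 < d * N * N ^ 2 := by gcongr
  have ha : a ≤ |a| * N ^ 2 := (le_abs_self a).trans (le_mul_of_one_le_right (abs_nonneg a)
    (one_le_pow₀ hN1))
  have hb : -b * N ≤ |b| * N ^ 2 := by
    have h3 : -b * N ≤ |b| * N := by gcongr; exact neg_le_abs b
    nlinarith [mul_nonneg (abs_nonneg b) (by linarith : (0 : ℝ) ≤ N)]
  have hc : c * N ^ 2 ≤ |c| * N ^ 2 := by gcongr; exact le_abs_self c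
  nlinarith

/-- A cubic that is negative at `-s < 0` has two negative zeros different from `-s`, and a
third one if its leading coefficient is positive, after addition of a large multiple of
`(t + s)²`. -/
theorem exists_real_zeros {a b c d s : ℝ} (hs : 0 < s)
    (hneg : a + b * (-s) + c * (-s) ^ 2 + d * (-s) ^ 3 < 0) :
    ∃ ρ x₁ x₂ : ℝ, x₁ < 0 ∧ x₂ < 0 ∧ x₁ ≠ x₂ ∧ x₁ ≠ -s ∧ x₂ ≠ -s ∧
      ρ ^ 2 * (x₁ + s) ^ 2 + (a + b * x₁ + c * x₁ ^ 2 + d * x₁ ^ 3) = 0 ∧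
      ρ ^ 2 * (x₂ + s) ^ 2 + (a + b * x₂ + c * x₂ ^ 2 + d * x₂ ^ 3) = 0 ∧
      ρ ≠ 0 ∧
      (0 < d → ∃ x₃ < 0, x₃ ≠ x₁ ∧ x₃ ≠ x₂ ∧ x₃ ≠ -s ∧
        ρ ^ 2 * (x₃ + s) ^ 2 + (a + b * x₃ + c * x₃ ^ 2 + d * x₃ ^ 3) = 0) := by
  set g : ℝ → ℝ := fun t => a + b * t + c * t ^ 2 + d * t ^ 3 with hg
  -- Large enough for ρ²(t + s)² to dominate g at -2s and -s/2, where (t + s)² is s² and s²/4. The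
  -- sum is then negative at -s and positive at these two points.
  set ρ : ℝ := 1 + (|g (-2 * s)| + 4 * |g (-s / 2)|) / s ^ 2 with hρ
  have hρ1 : 1 ≤ ρ := by
    have : 0 ≤ (|g (-2 * s)| + 4 * |g (-s / 2)|) / s ^ 2 := by positivity
    linarith
  have hρs : |g (-2 * s)| + 4 * |g (-s / 2)| < ρ ^ 2 * s ^ 2 := by
    have h1 : ρ * s ^ 2 = s ^ 2 + (|g (-2 * s)| + 4 * |g (-s / 2)|) := by
      rw [hρ]; field_simp
    have h2 : 0 < s ^ 2 := by positivity
    have h3 : ρ * s ^ 2 ≤ ρ ^ 2 * s ^ 2 := by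
      gcongr
      exact le_self_pow₀ hρ1 two_ne_zero
    linarith
  set G : ℝ → ℝ := fun t => ρ ^ 2 * (t + s) ^ 2 + g t with hG
  have hGc : Continuous G := by fun_prop
  have hG0 : G (-s) < 0 := by simp only [hG, hg]; linarith
  have hG1 : 0 < G (-2 * s) := by
    have : G (-2 * s) = ρ ^ 2 * s ^ 2 + g (-2 * s) := by simp only [hG]; ring
    rw [this]
    linarith [neg_abs_le (g (-2 * s)), abs_nonneg (g (-s / 2))]
  have hG2 : 0 < G (-s / 2) := by
    have : G (-s / 2) = ρ ^ 2 * s ^ 2 / 4 + g (-s / 2) := by simp only [hG]; ring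
    rw [this]
    linarith [neg_abs_le (g (-s / 2)), abs_nonneg (g (-2 * s))]
  obtain ⟨x₁, ⟨h1, h1'⟩, e1⟩ := intermediate_value_Ioo' (by linarith : -2 * s ≤ -s)
    hGc.continuousOn ⟨hG0, hG1⟩
  obtain ⟨x₂, ⟨h2, h2'⟩, e2⟩ := intermediate_value_Ioo (by linarith : -s ≤ -s / 2)
    hGc.continuousOn ⟨hG0, hG2⟩
  refine ⟨ρ, x₁, x₂, by linarith, by linarith, by linarith, h1'.ne, h2.ne', e1, e2,
    by linarith, fun hd => ?_⟩
  obtain ⟨M, hM, hM'⟩ := exists_cubic_neg (a + ρ ^ 2 * s ^ 2) (b + 2 * ρ ^ 2 * s) (c + ρ ^ 2) hd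
    (-2 * s)
  have hGM : G M < 0 := by simp only [hG, hg]; linarith
  obtain ⟨x₃, ⟨-, h3⟩, e3⟩ := intermediate_value_Ioo hM.le hGc.continuousOn ⟨hGM, hG1⟩
  exact ⟨x₃, by linarith, by linarith, by linarith, by linarith, e3⟩

/-! ### Closing sequences in complex coordinates -/

theorem coeff_mul_one_add_X_mul_C_zero (p : Polynomial ℍ[ℝ]) (v : ℍ[ℝ]) :
    (p * (1 + Polynomial.X * Polynomial.C v)).coeff 0 = p.coeff 0 := by
  rw [mul_add, mul_one, ← mul_assoc, Polynomial.coeff_add, Polynomial.coeff_mul_C,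
    Polynomial.coeff_mul_X_zero, zero_mul, add_zero]

theorem coeff_mul_one_add_X_mul_C_succ (p : Polynomial ℍ[ℝ]) (v : ℍ[ℝ]) (k : ℕ) :
    (p * (1 + Polynomial.X * Polynomial.C v)).coeff (k + 1) =
      p.coeff (k + 1) + p.coeff k * v := by
  rw [mul_add, mul_one, ← mul_assoc, Polynomial.coeff_add, Polynomial.coeff_mul_C,
    Polynomial.coeff_mul_X]

theorem inner_im_even_even (z w : ℂ) :
    inner ℝ (evenQuat z).im (evenQuat w).im = z.im * w.im := by
  rw [Quaternion.inner_def]; simp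

theorem inner_im_even_odd (z w : ℂ) : inner ℝ (evenQuat z).im (oddQuat w).im = (0 : ℝ) := by
  rw [Quaternion.inner_def]; simp

theorem inner_im_odd_even (z w : ℂ) : inner ℝ (oddQuat z).im (evenQuat w).im = (0 : ℝ) := by
  rw [Quaternion.inner_def]; simp

theorem inner_im_odd_odd (z w : ℂ) :
    inner ℝ (oddQuat z).im (oddQuat w).im = (z * conj w).re := by
  rw [Quaternion.inner_def]; simp; ring

namespace ThreeStep

variable {η : ℝ} {f : ℤ → Plane} (S : ThreeStep η f)

/-- The complex coordinate of `E`. -/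
def cE : ℂ := ⟨S.E.re, S.E.imK⟩

/-- The complex coordinate of the transport quaternion `v⁽ⁱ⁾_n`. -/
def cv (i : Fin 3) (n : ℤ) : ℂ := toComplex (S.seq i.succ n) - toComplex (S.seq i.castSucc n)

/-- The complex coordinate of `C¹`. -/
def cOne (n : ℤ) : ℂ := S.cE * S.cv 2 n + S.cE * S.cv 1 n + S.cE * S.cv 0 n

/-- The complex coordinate of `C²`. -/
def cTwo (n : ℤ) : ℂ := -(S.cE * S.cv 2 n * conj (S.cv 1 n)) -
  (S.cE * S.cv 2 n + S.cE * S.cv 1 n) * conj (S.cv 0 n)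

/-- The complex coordinate of `C³`. -/
def cThree (n : ℤ) : ℂ := -(S.cE * S.cv 2 n * conj (S.cv 1 n)) * S.cv 0 n

theorem E_eq : S.E = evenQuat S.cE := by
  ext
  · rfl
  · exact S.E_imI
  · exact S.E_imJ
  · rfl

theorem cE_ne_zero : S.cE ≠ 0 := by
  intro h
  apply S.E_ne_zero
  rw [E_eq, h]
  ext <;> simp

theorem v_eq (i : Fin 3) (n : ℤ) : S.v i n = oddQuat (S.cv i n) := by
  rw [v, toQuat_eq, toQuat_eq, cv, oddQuat_sub]

theorem coeff_zero (n : ℤ) : S.coeff 0 n = evenQuat S.cE := by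
  rw [coeff, poly]
  simp only [coeff_mul_one_add_X_mul_C_zero, Polynomial.coeff_C_zero, E_eq]

theorem coeff_one (n : ℤ) : S.coeff 1 n = oddQuat (S.cOne n) := by
  rw [coeff, poly]
  simp only [coeff_mul_one_add_X_mul_C_zero, coeff_mul_one_add_X_mul_C_succ,
    Polynomial.coeff_C_zero, Polynomial.coeff_C_succ, E_eq, v_eq, evenQuat_mul_oddQuat, zero_add,
    ← oddQuat_add]
  rw [cOne]

theorem coeff_two (n : ℤ) : S.coeff 2 n = evenQuat (S.cTwo n) := by
  rw [coeff, poly]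
  simp only [coeff_mul_one_add_X_mul_C_zero, coeff_mul_one_add_X_mul_C_succ,
    Polynomial.coeff_C_zero, Polynomial.coeff_C_succ, E_eq, v_eq, evenQuat_mul_oddQuat, zero_add,
    ← oddQuat_add, oddQuat_mul_oddQuat, zero_mul, ← evenQuat_add]
  rw [cTwo, sub_eq_add_neg]

theorem coeff_three (n : ℤ) : S.coeff 3 n = oddQuat (S.cThree n) := by
  rw [coeff, poly]
  simp only [coeff_mul_one_add_X_mul_C_succ, Polynomial.coeff_C_zero, Polynomial.coeff_C_succ,
    E_eq, v_eq, evenQuat_mul_oddQuat, zero_add, oddQuat_mul_oddQuat, zero_mul]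
  rw [cThree]

theorem coeff_add_four (j : ℕ) (n : ℤ) : S.coeff (j + 4) n = 0 := by
  rw [coeff, poly]
  simp only [coeff_mul_one_add_X_mul_C_succ, Polynomial.coeff_C_succ, zero_mul, add_zero]

theorem coeff_of_three_lt {j : ℕ} (hj : 3 < j) (n : ℤ) : S.coeff j n = 0 := by
  obtain ⟨k, rfl⟩ := Nat.exists_eq_add_of_lt hj
  rw [show 3 + k + 1 = k + 4 by ring]
  exact S.coeff_add_four k n

theorem theta_zero (n : ℤ) : S.theta 0 n = S.E.imK ^ 2 := by
  simp only [theta, Finset.sum_range_succ, Finset.sum_range_zero, Nat.sub_zero, coeff_zero,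
    inner_im_even_even]
  rw [cE]
  ring

theorem theta_two (n : ℤ) :
    S.theta 2 n = 2 * S.E.imK * (S.cTwo n).im + (S.cOne n * conj (S.cOne n)).re := by
  simp only [theta, Finset.sum_range_succ, Finset.sum_range_zero, Nat.reduceSub, coeff_zero,
    coeff_one, coeff_two, inner_im_even_even, inner_im_odd_odd]
  rw [cE]
  ring

theorem theta_four (n : ℤ) :
    S.theta 4 n = (S.cTwo n).im ^ 2 + 2 * (S.cOne n * conj (S.cThree n)).re := by
  simp only [theta, Finset.sum_range_succ, Finset.sum_range_zero, Nat.reduceSub, coeff_zero,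
    coeff_one, coeff_two, coeff_three, inner_im_even_even, inner_im_odd_odd,
    S.coeff_of_three_lt (Nat.lt_succ_self 3), Quaternion.im_zero, inner_zero_left,
    inner_zero_right]
  simp only [Complex.mul_re, Complex.conj_re, Complex.conj_im]
  ring

theorem theta_six (n : ℤ) : S.theta 6 n = (S.cThree n * conj (S.cThree n)).re := by
  simp only [theta, Finset.sum_range_succ, Finset.sum_range_zero, Nat.reduceSub,
    coeff_three, inner_im_odd_odd, S.coeff_of_three_lt (by norm_num : 3 < 4),
    S.coeff_of_three_lt (by norm_num : 3 < 5), S.coeff_of_three_lt (by norm_num : 3 < 6),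
    Quaternion.im_zero, inner_zero_left, inner_zero_right]
  ring

theorem theta_one (n : ℤ) : S.theta 1 n = 0 := by
  simp only [theta, Finset.sum_range_succ, Finset.sum_range_zero, Nat.reduceSub, coeff_zero,
    coeff_one, inner_im_even_odd, inner_im_odd_even, add_zero]

theorem theta_three (n : ℤ) : S.theta 3 n = 0 := by
  simp only [theta, Finset.sum_range_succ, Finset.sum_range_zero, Nat.reduceSub, coeff_zero,
    coeff_one, coeff_two, coeff_three, inner_im_even_odd, inner_im_odd_even, add_zero]

theorem theta_five (n : ℤ) : S.theta 5 n = 0 := by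
  simp only [theta, Finset.sum_range_succ, Finset.sum_range_zero, Nat.reduceSub,
    coeff_two, coeff_three, S.coeff_of_three_lt (by norm_num : 3 < 4),
    S.coeff_of_three_lt (by norm_num : 3 < 5), Quaternion.im_zero, inner_zero_left,
    inner_zero_right, inner_im_even_odd, inner_im_odd_even, add_zero]

theorem theta_of_six_lt {j : ℕ} (hj : 6 < j) (n : ℤ) : S.theta j n = 0 := by
  refine Finset.sum_eq_zero fun k _ => ?_
  rcases lt_or_ge 3 k with hk | hk
  · rw [S.coeff_of_three_lt hk, Quaternion.im_zero, inner_zero_left]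
  · rw [S.coeff_of_three_lt (by omega : 3 < j - k), Quaternion.im_zero, inner_zero_right]

theorem detVec_eq (n : ℤ) : S.detVec n = ((S.theta 0 n - S.theta 2 n / η ^ 2 +
    S.theta 4 n / η ^ 4 - S.theta 6 n / η ^ 6 : ℝ) : ℂ) := by
  have h4 : I ^ 4 = 1 := Complex.I_pow_four
  have h6 : I ^ 6 = -1 := by rw [show (6 : ℕ) = 4 + 2 by norm_num, pow_add, h4]; simp
  simp only [detVec, Finset.sum_range_succ, Finset.sum_range_zero, theta_one, theta_three,
    theta_five, div_pow, Complex.I_sq, h4, h6]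
  push_cast
  ring

theorem cEdge_succ (i : Fin 3) (n : ℤ) :
    cEdge (S.seq i.succ) n = cEdge (S.seq i.castSucc) n + S.cv i (n + 1) - S.cv i n := by
  simp only [cEdge, cv]; ring

theorem cv_succ (i : Fin 3) (n : ℤ) :
    S.cv i (n + 1) * conj (cEdge (S.seq i.castSucc) n - S.cv i n) =
      (cEdge (S.seq i.castSucc) n - S.cv i n) * conj (S.cv i n) :=
  (S.backlund i).butterfly_eq n

theorem cE_mul_cEdge_three (n : ℤ) :
    S.cE * cEdge (S.seq 3) n = cEdge f n * conj S.cE := by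
  have h : ∀ m, toComplex (S.seq 3 m) =
      S.cE⁻¹ * toComplex (f m) * conj S.cE + toComplex S.shift := by
    intro m
    apply oddQuat_injective
    rw [← toQuat_eq, S.isometry, E_eq, evenQuat_inv, toQuat_eq, evenQuat_mul_oddQuat,
      oddQuat_mul_evenQuat, toQuat_eq, ← oddQuat_add]
  rw [cEdge, cEdge, h, h]
  have := S.cE_ne_zero
  field_simp
  ring

/-- The constant E intertwines the last curve with f by the closing condition; the factors of v⁽²⁾,
v⁽¹⁾, v⁽⁰⁾ are then multiplied on from the right. -/
theorem intertwines : Intertwines S.cE (cEdge f) (cEdge f) S.cOne S.cTwo S.cThree := by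
  have h3 : Intertwines S.cE (cEdge (S.seq 3)) (cEdge f) 0 0 0 :=
    ⟨fun n => by simpa using S.cE_mul_cEdge_three n, fun n => by simp, fun n => by simp,
      fun n => by simp⟩
  have h2 := h3.comp (S.cEdge_succ 2) (S.cv_succ 2)
  have h2' : Intertwines S.cE (cEdge (S.seq 2)) (cEdge f) (fun n => S.cE * S.cv 2 n) 0 0 := by
    convert h2 using 2 <;> simp
  have h1 := h2'.comp (S.cEdge_succ 1) (S.cv_succ 1)
  have h1' : Intertwines S.cE (cEdge (S.seq 1)) (cEdge f)
      (fun n => S.cE * S.cv 2 n + S.cE * S.cv 1 n)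
      (fun n => -(S.cE * S.cv 2 n * conj (S.cv 1 n))) 0 := by
    convert h1 using 2 <;> simp
  have h0 := h1'.comp (S.cEdge_succ 0) (S.cv_succ 0)
  have hs : S.seq (Fin.castSucc 0) = f := S.seq_zero
  rw [hs] at h0
  exact h0

end ThreeStep

/-! ### The invariants of a closing sequence -/

/-- Half the curvature, measured in units of the inverse edge length. -/
def halfCurvature (η : ℝ) (f : ℤ → Plane) (n : ℤ) : ℝ := η / 2 * curvature f n

theorem mul_re_add_I_mul_im_div {u : ℂ} (hu : u ≠ 0) (c : ℂ) :
    u * ((c / u).re + I * (c / u).im) = c := by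
  rw [mul_comm I, Complex.re_add_im, mul_div_cancel₀ _ hu]

theorem mul_conj_re_of_coordinates {u : ℂ} {η : ℝ} (hu : u * conj u = (η : ℂ) ^ 2)
    (a b c d : ℝ) : (u * (a + I * b) * conj (u * (c + I * d))).re = η ^ 2 * (a * c + b * d) := by
  have h : u * (a + I * b) * conj (u * (c + I * d)) =
      ((η ^ 2 * (a * c + b * d) : ℝ) : ℂ) + ((η ^ 2 * (b * c - a * d) : ℝ) : ℂ) * I := by
    simp only [map_add, map_mul, Complex.conj_I, Complex.conj_ofReal]
    push_cast
    linear_combination ((a + I * b) * (c - I * d)) * hu - η ^ 2 * b * d * Complex.I_sq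
  rw [h, Complex.add_re, Complex.ofReal_re, Complex.re_ofReal_mul, Complex.I_re, mul_zero, add_zero]

/-- The coordinates of an odd coefficient in the moving frame of the edges. -/
def frame (f : ℤ → Plane) (c : ℤ → ℂ) (n : ℤ) : ℂ := c n / cEdge f n

namespace ThreeStep

variable {η : ℝ} {f : ℤ → Plane} (S : ThreeStep η f)

theorem cTwo_re (hf : IsArcLengthCurve η f) (m n : ℤ) : (S.cTwo m).re = (S.cTwo n).re := by
  refine eq_of_forall_succ_eq (s := fun n => (S.cTwo n).re) (fun n => ?_) m n
  have h1 := S.intertwines.one n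
  have h2 := S.intertwines.two n
  have hc : conj S.cE = S.cE - 2 * I * S.cE.im := by
    apply Complex.ext <;> simp
    ring
  have h3 : S.cTwo (n + 1) = S.cTwo n + (S.cOne n * conj (cEdge f n) -
      conj (S.cOne n * conj (cEdge f n))) - ((2 * S.cE.im * η ^ 2 : ℝ) : ℂ) * I := by
    simp only [map_mul, Complex.conj_conj]
    push_cast
    linear_combination h2 + conj (cEdge f n) * h1 - (2 * I * S.cE.im) * hf.cEdge_mul_conj n +
      cEdge f n * conj (cEdge f n) * hc
  rw [h3, Complex.sub_re, Complex.add_re, Complex.re_ofReal_mul, Complex.sub_re, Complex.conj_re,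
    Complex.I_re]
  ring

theorem closedCoordinates (hf : IsArcLengthCurve η f) :
    ClosedCoordinates η S.E.imK (halfCurvature η f) (fun n => (frame f S.cOne n).re)
      (fun n => (frame f S.cOne n).im) (fun n => (frame f S.cThree n).re)
      (fun n => (frame f S.cThree n).im) (fun n => (S.cTwo n).im) := by
  refine (intertwines_iff_closedCoordinates (ρ := S.E.re) (ρ' := (S.cTwo 0).re)
    (K := halfCurvature η f) hf.pos.ne' hf.cEdge_mul_conj hf.cEdge_rotation).1 ?_
  convert S.intertwines using 2
  · apply Complex.ext <;> simp [cE]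
  · exact mul_re_add_I_mul_im_div (hf.cEdge_ne_zero _) _
  · rw [S.cTwo_re hf 0, mul_comm, Complex.re_add_im]
  · exact mul_re_add_I_mul_im_div (hf.cEdge_ne_zero _) _

theorem cOne_eq (hf : IsArcLengthCurve η f) (n : ℤ) :
    S.cOne n = cEdge f n * ((frame f S.cOne n).re + I * (frame f S.cOne n).im) :=
  (mul_re_add_I_mul_im_div (hf.cEdge_ne_zero n) _).symm

theorem cThree_eq (hf : IsArcLengthCurve η f) (n : ℤ) :
    S.cThree n = cEdge f n * ((frame f S.cThree n).re + I * (frame f S.cThree n).im) :=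
  (mul_re_add_I_mul_im_div (hf.cEdge_ne_zero n) _).symm

theorem theta_two_eq (hf : IsArcLengthCurve η f) (n : ℤ) :
    S.theta 2 n = 2 * S.E.imK * (S.cTwo n).im +
      η ^ 2 * ((frame f S.cOne n).re ^ 2 + (frame f S.cOne n).im ^ 2) := by
  rw [theta_two, S.cOne_eq hf, mul_conj_re_of_coordinates (hf.cEdge_mul_conj n), ← sq, ← sq]

theorem theta_four_eq (hf : IsArcLengthCurve η f) (n : ℤ) :
    S.theta 4 n = (S.cTwo n).im ^ 2 +
      2 * η ^ 2 * ((frame f S.cOne n).re * (frame f S.cThree n).re +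
        (frame f S.cOne n).im * (frame f S.cThree n).im) := by
  rw [theta_four, S.cOne_eq hf, S.cThree_eq hf, mul_conj_re_of_coordinates (hf.cEdge_mul_conj n),
    mul_assoc]

theorem theta_six_eq (hf : IsArcLengthCurve η f) (n : ℤ) :
    S.theta 6 n = η ^ 2 * ((frame f S.cThree n).re ^ 2 + (frame f S.cThree n).im ^ 2) := by
  rw [theta_six, S.cThree_eq hf, mul_conj_re_of_coordinates (hf.cEdge_mul_conj n), ← sq, ← sq]

theorem theta_const (hf : IsArcLengthCurve η f) (j : ℕ) (m n : ℤ) :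
    S.theta j m = S.theta j n := by
  have h := S.closedCoordinates hf
  rcases lt_or_ge 6 j with hj | hj
  · rw [S.theta_of_six_lt hj, S.theta_of_six_lt hj]
  · interval_cases j
    · rw [theta_zero, theta_zero]
    · rw [theta_one, theta_one]
    · rw [S.theta_two_eq hf, S.theta_two_eq hf]; exact h.theta_two m n
    · rw [theta_three, theta_three]
    · rw [S.theta_four_eq hf, S.theta_four_eq hf]; exact h.theta_four hf.pos.ne' m n
    · rw [theta_five, theta_five]
    · rw [S.theta_six_eq hf, S.theta_six_eq hf]; exact h.theta_six m n

theorem exists_beta (hf : IsArcLengthCurve η f) : ∃ β : ℝ,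
    (∀ n, (frame f S.cThree n).re = η ^ 2 * (frame f S.cOne n).re + β ∧
      (S.cTwo n).im = η ^ 2 * S.E.imK - β * halfCurvature η f n ∧
      (frame f S.cThree n).im = η ^ 2 * (frame f S.cOne n).im - β * halfCurvature η f n) ∧
    (∀ n, S.cThree n - η ^ 2 * S.cOne n = β * cTangent f n) ∧
    ∀ n, S.detVec n = -((β ^ 2 / η ^ 4 : ℝ) : ℂ) := by
  obtain ⟨β, h⟩ := (S.closedCoordinates hf).exists_beta
  have hη := hf.pos.ne'
  refine ⟨β, h, fun n => ?_, fun n => ?_⟩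
  · obtain ⟨hZ, -, hV⟩ := h n
    rw [S.cOne_eq hf, S.cThree_eq hf, hf.cTangent_eq]
    rw [hZ, hV, halfCurvature]
    push_cast
    ring
  · obtain ⟨hZ, hy, hV⟩ := h n
    rw [detVec_eq, theta_zero, S.theta_two_eq hf, S.theta_four_eq hf, S.theta_six_eq hf, hZ, hV,
      hy, ← Complex.ofReal_neg]
    congr 1
    field_simp
    ring

/-- Degeneracy means β = 0; for nonconstant curvature this kills the whole trace-free part of 𝒫,
contradicting regularity. -/
theorem isNondegenerate_of_curvature_ne (hf : IsArcLengthCurve η f)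
    (hκ : ∃ m n, curvature f m ≠ curvature f n) (hS : S.IsRegular) : S.IsNondegenerate := by
  intro n₀ h0
  obtain ⟨β, hβ, -, hdet⟩ := S.exists_beta hf
  have hη := hf.pos.ne'
  have hβ0 : β = 0 := by
    rw [hdet, neg_eq_zero, Complex.ofReal_eq_zero, div_eq_zero_iff] at h0
    exact pow_eq_zero_iff two_ne_zero |>.1 (h0.resolve_right (pow_ne_zero 4 hη))
  simp only [hβ0, zero_mul, sub_zero, add_zero] at hβ
  rcases (S.closedCoordinates hf).const_of_beta_eq_zero hη fun n => (hβ n).2.1 with hK | ⟨hε, hXY⟩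
  · obtain ⟨m, n, hmn⟩ := hκ
    exact hmn (mul_left_cancel₀ (div_ne_zero hη two_ne_zero) (hK m n))
  · obtain ⟨n, j, hj⟩ := hS
    apply hj
    obtain ⟨hX, hY⟩ := hXY n
    obtain ⟨hZ, hy, hV⟩ := hβ n
    rw [hX, mul_zero] at hZ
    rw [hY, mul_zero] at hV
    rw [hε, mul_zero] at hy
    rcases lt_or_ge 3 j with h3 | h3
    · rw [S.coeff_of_three_lt h3, Quaternion.im_zero]
    · interval_cases j
      · rw [coeff_zero]
        ext <;> simp [cE, hε]
      · rw [coeff_one, S.cOne_eq hf, hX, hY]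
        ext <;> simp
      · rw [coeff_two]
        ext <;> simp [hy]
      · rw [coeff_three, S.cThree_eq hf, hZ, hV]
        ext <;> simp

/-- The first coefficient of a nondegenerate closing sequence as a linear combination of the mKdV
flow and the tangent flow. -/
theorem cOne_eq_flow (hf : IsArcLengthCurve η f) {β : ℝ} (hβ : β ≠ 0)
    (h : ∀ n, (frame f S.cThree n).re = η ^ 2 * (frame f S.cOne n).re + β ∧
      (S.cTwo n).im = η ^ 2 * S.E.imK - β * halfCurvature η f n ∧
      (frame f S.cThree n).im = η ^ 2 * (frame f S.cOne n).im - β * halfCurvature η f n) (n : ℤ) :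
    S.cOne n = ((-β / (2 * η ^ 2) : ℝ) : ℂ) * cMKdV f n +
      ((1 / (2 * β * η ^ 4) * (S.theta 6 0 - η ^ 4 * S.theta 2 0 + 2 * η ^ 6 * S.theta 0 0) : ℝ)
        : ℂ) * cTangent f n := by
  rw [S.theta_const hf 6 0 n, S.theta_const hf 2 0 n, S.theta_zero, S.theta_two_eq hf,
    S.theta_six_eq hf]
  have hXY := (S.closedCoordinates hf).coordinates_eq hf.pos.ne' hβ (fun n => (h n).1)
    (fun n => (h n).2.1) (fun n => (h n).2.2) n rfl rfl rfl
  obtain ⟨hX, hY⟩ := hXY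
  set b : ℝ := 1 / (2 * β * η ^ 4) *
    (η ^ 2 * ((frame f S.cThree n).re ^ 2 + (frame f S.cThree n).im ^ 2) -
      η ^ 4 * (2 * S.E.imK * (S.cTwo n).im +
        η ^ 2 * ((frame f S.cOne n).re ^ 2 + (frame f S.cOne n).im ^ 2)) +
      2 * η ^ 6 * S.E.imK ^ 2) with hb
  rw [S.cOne_eq hf, hf.cMKdV_eq, hf.cTangent_eq]
  clear_value b
  rw [hX, hY]
  simp only [halfCurvature]
  push_cast
  set q : ℂ := -β / (2 * η ^ 2)
  linear_combination (q * (η / 2 * curvature f n) * cEdge f n *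
    ((η / 2 * curvature f (n + 1) - η / 2 * curvature f (n - 1)) / 2)) * Complex.I_sq

/-- The λ-coefficient of the intertwining relation, C¹_{n+1} - C¹_n = u_n Ē - E u_n in complex
coordinates, telescopes. -/
theorem cOne_eq_infinitesimal (n : ℤ) :
    S.cOne n = toComplex (f n) * conj S.cE - S.cE * toComplex (f n) +
      (S.cOne 0 - (toComplex (f 0) * conj S.cE - S.cE * toComplex (f 0))) := by
  rw [eq_of_forall_succ_eq
    (s := fun n => S.cOne n - (toComplex (f n) * conj S.cE - S.cE * toComplex (f n)))
    (fun n => ?_) 0 n]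
  · ring
  · have := S.intertwines.one n
    rw [cEdge] at this
    linear_combination this

theorem exists_invariants (hf : IsArcLengthCurve η f) (hS : S.IsNondegenerate) :
    ∃ (θ : ℕ → ℝ) (β : ℝ),
      (∀ j n, S.theta j n = θ j) ∧
      β ≠ 0 ∧
      (∀ n, (β : ℂ) ^ 2 = -(-(η : ℂ) ^ 2) ^ 2 * S.detVec n) ∧
      (∀ n, S.coeff 3 n - η ^ 2 • S.coeff 1 n = β • tangentFlow f n) ∧
      (∀ n, S.coeff 1 n = (-β / (2 * η ^ 2)) • mKdVFlow f n +
        (1 / (2 * β * η ^ 4) * (θ 6 - η ^ 4 * θ 2 + 2 * η ^ 6 * θ 0)) • tangentFlow f n) ∧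
      (∃ c : Plane, ∀ n, S.coeff 1 n =
        toQuat (f n) * S.E - S.E * toQuat (f n) + toQuat c) ∧
      IsInvariantUnderFlow (fun g n => (-β / (2 * η ^ 2)) • mKdVFlow g n +
        (1 / (2 * β * η ^ 4) * (θ 6 - η ^ 4 * θ 2 + 2 * η ^ 6 * θ 0)) • tangentFlow g n) f := by
  obtain ⟨β, h, hT, hdet⟩ := S.exists_beta hf
  have hη : (η : ℂ) ≠ 0 := by exact_mod_cast hf.pos.ne'
  have hβ : β ≠ 0 := by
    rintro rfl
    apply hS 0
    rw [hdet]
    simp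
  refine ⟨fun j => S.theta j 0, β, fun j n => S.theta_const hf j n 0, hβ, fun n => ?_, fun n => ?_,
    fun n => ?_, ⟨ofComplex (S.cOne 0 - (toComplex (f 0) * conj S.cE - S.cE * toComplex (f 0))),
      fun n => ?_⟩, ?_⟩
  · rw [hdet]
    push_cast
    field_simp
  · rw [coeff_one, coeff_three, tangentFlow_eq, smul_oddQuat, smul_oddQuat, ← oddQuat_sub, ← hT]
    push_cast
    rfl
  · rw [flow_eq, coeff_one, S.cOne_eq_flow hf hβ h]
  · rw [coeff_one, toQuat_eq, toQuat_eq, toComplex_ofComplex, E_eq, oddQuat_mul_evenQuat,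
      evenQuat_mul_oddQuat, ← oddQuat_sub, ← oddQuat_add, ← S.cOne_eq_infinitesimal]
  · refine isInvariantUnderFlow_of_infinitesimal (ω := -2 * S.E.imK)
      (τ := S.cOne 0 - (toComplex (f 0) * conj S.cE - S.cE * toComplex (f 0))) fun n => ?_
    rw [← S.cOne_eq_flow hf hβ h, S.cOne_eq_infinitesimal n]
    have hc : conj S.cE = S.cE - 2 * I * S.E.imK := by
      apply Complex.ext <;> simp [cE]
      ring
    push_cast
    linear_combination toComplex (f n) * hc

end ThreeStep

/-! ### Closing sequences of area-constrained elastic curves -/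

/-- Three fields of transformation vectors that solve the evolution equations of the butterflies
and close up to a rotation give a closing sequence. -/
theorem exists_threeStep {η ℓ₀ ℓ₁ ℓ₂ : ℝ} {f : ℤ → Plane} (hf : IsArcLengthCurve η f) {E : ℂ}
    (hE : E ≠ 0) {v₀ v₁ v₂ u₁ u₂ u₃ : ℤ → ℂ}
    (hℓ₀ : ℓ₀ ≠ η) (hℓ₁ : ℓ₁ ≠ η) (hℓ₂ : ℓ₂ ≠ η)
    (hv₀ : ∀ n, ‖v₀ n‖ = ℓ₀) (hv₁ : ∀ n, ‖v₁ n‖ = ℓ₁) (hv₂ : ∀ n, ‖v₂ n‖ = ℓ₂)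
    (hu₁ : ∀ n, u₁ n = cEdge f n + v₀ (n + 1) - v₀ n)
    (hu₂ : ∀ n, u₂ n = u₁ n + v₁ (n + 1) - v₁ n)
    (hu₃ : ∀ n, u₃ n = u₂ n + v₂ (n + 1) - v₂ n)
    (hb₀ : ∀ n, v₀ (n + 1) * conj (cEdge f n - v₀ n) = (cEdge f n - v₀ n) * conj (v₀ n))
    (hb₁ : ∀ n, v₁ (n + 1) * conj (u₁ n - v₁ n) = (u₁ n - v₁ n) * conj (v₁ n))
    (hb₂ : ∀ n, v₂ (n + 1) * conj (u₂ n - v₂ n) = (u₂ n - v₂ n) * conj (v₂ n))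
    (hclose : ∀ n, E * u₃ n = cEdge f n * conj E) :
    ∃ S : ThreeStep η f, S.cE = E ∧ S.cv 0 = v₀ ∧ S.cv 1 = v₁ ∧ S.cv 2 = v₂ := by
  obtain ⟨hf₁, hB₀⟩ := backlund_of_field hf hv₀ hℓ₀ hb₀
  set f₁ : ℤ → Plane := fun n => ofComplex (toComplex (f n) + v₀ n) with hf₁_def
  have he₁ : ∀ n, cEdge f₁ n = u₁ n := fun n => by
    rw [hu₁, cEdge, cEdge]; simp only [hf₁_def, toComplex_ofComplex]; ring
  obtain ⟨hf₂, hB₁⟩ := backlund_of_field hf₁ hv₁ hℓ₁ fun n => by rw [he₁]; exact hb₁ n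
  set f₂ : ℤ → Plane := fun n => ofComplex (toComplex (f₁ n) + v₁ n) with hf₂_def
  have he₂ : ∀ n, cEdge f₂ n = u₂ n := fun n => by
    rw [hu₂, ← he₁, cEdge, cEdge]; simp only [hf₂_def, toComplex_ofComplex]; ring
  obtain ⟨hf₃, hB₂⟩ := backlund_of_field hf₂ hv₂ hℓ₂ fun n => by rw [he₂]; exact hb₂ n
  set f₃ : ℤ → Plane := fun n => ofComplex (toComplex (f₂ n) + v₂ n) with hf₃_def
  have he₃ : ∀ n, cEdge f₃ n = u₃ n := fun n => by
    rw [hu₃, ← he₂, cEdge, cEdge]; simp only [hf₃_def, toComplex_ofComplex]; ring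
  have hiso : ∀ n, toComplex (f₃ n) - E⁻¹ * toComplex (f n) * conj E =
      toComplex (f₃ 0) - E⁻¹ * toComplex (f 0) * conj E := by
    intro n
    refine eq_of_forall_succ_eq
      (s := fun n => toComplex (f₃ n) - E⁻¹ * toComplex (f n) * conj E) (fun n => ?_) n 0
    have h := hclose n
    rw [← he₃, cEdge, cEdge] at h
    field_simp
    linear_combination h
  refine ⟨{ seq := ![f, f₁, f₂, f₃]
            E := evenQuat E
            shift := ofComplex (toComplex (f₃ 0) - E⁻¹ * toComplex (f 0) * conj E)
            seq_zero := rfl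
            curve := ?_
            backlund := ?_
            E_ne_zero := fun h => hE ?_
            E_imI := rfl
            E_imJ := rfl
            isometry := fun n => ?_ }, rfl, ?_, ?_, ?_⟩
  · intro i
    fin_cases i
    · exact hf
    · exact hf₁
    · exact hf₂
    · exact hf₃
  · intro i
    fin_cases i
    · exact hB₀
    · exact hB₁
    · exact hB₂
  · exact Complex.ext (congrArg QuaternionAlgebra.re h) (congrArg QuaternionAlgebra.imK h)
  · change toQuat (f₃ n) = _
    rw [toQuat_eq, toQuat_eq, toQuat_eq, evenQuat_inv, evenQuat_mul_oddQuat, oddQuat_mul_evenQuat,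
      ← oddQuat_add, toComplex_ofComplex (toComplex (f₃ 0) - _), ← hiso n]
    congr 1
    ring
  · funext n
    change toComplex (f₁ n) - toComplex (f n) = _
    simp [hf₁_def]
  · funext n
    change toComplex (f₂ n) - toComplex (f₁ n) = _
    simp [hf₂_def]
  · funext n
    change toComplex (f₃ n) - toComplex (f₂ n) = _
    simp [hf₃_def]

theorem sqrt_neg_inv_ne {η x : ℝ} (hx : x < 0) (h : x ≠ -(1 / η ^ 2)) :
    √(-x⁻¹) ≠ η := by
  intro h0
  apply h
  have h1 : -x⁻¹ = η ^ 2 := by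
    rw [← h0, Real.sq_sqrt]
    exact neg_nonneg.2 (inv_nonpos.2 hx.le)
  rw [← h1]
  field_simp

theorem ne_zero_of_mul_conj {x : ℝ} {v : ℂ} (h : x * (v * conj v) = -1) : v ≠ 0 := by
  rintro rfl
  simp at h

/-- A polynomial of degree three that intertwines a curve with itself is the polynomial of a
closing sequence if its determinant has enough simple negative zeros. -/
theorem exists_threeStep_of_intertwines {η : ℝ} {f : ℤ → Plane} (hf : IsArcLengthCurve η f)
    {E : ℂ} (hE : E ≠ 0) {c γ w : ℤ → ℂ} (h : Intertwines E (cEdge f) (cEdge f) c γ w)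
    {x₀ x₁ : ℝ} (hx₀ : x₀ < 0) (hx₁ : x₁ < 0) (h01 : x₀ ≠ x₁)
    (hη₀ : x₀ ≠ -(1 / η ^ 2)) (hη₁ : x₁ ≠ -(1 / η ^ 2))
    (hd₀ : ∀ n, polyDet E (c n) (γ n) (w n) x₀ = 0) (hA₀ : ∀ n, E + x₀ * γ n ≠ 0)
    (hd₁ : ∀ n, polyDet E (c n) (γ n) (w n) x₁ = 0) (hA₁ : ∀ n, E + x₁ * γ n ≠ 0)
    (h2 : (∀ n, w n = 0) ∨ ∃ x₂ < 0, x₂ ≠ x₀ ∧ x₂ ≠ x₁ ∧ x₂ ≠ -(1 / η ^ 2) ∧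
      (∀ n, polyDet E (c n) (γ n) (w n) x₂ = 0) ∧ ∀ n, E + x₂ * γ n ≠ 0) :
    ∃ S : ThreeStep η f, S.cE = E ∧ (∀ n, S.cOne n = c n) ∧ ∀ n, S.cThree n = w n := by
  obtain ⟨v₀, c₁, γ₁, hxv₀, hb₀, hc₀, hγ₀, hw₀, h₁⟩ := h.exists_factor hA₀ hd₀
  have hq₁ := fun n => polyDet_quotient (hxv₀ n) (hc₀ n) (hγ₀ n) (hw₀ n) h01.symm hx₁.ne (hd₁ n)
    (hA₁ n)
  obtain ⟨v₁, c₂, γ₂, hxv₁, hb₁, hc₁, hγ₁, hw₁, h₂⟩ :=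
    h₁.exists_factor (fun n => (hq₁ n).2) (fun n => (hq₁ n).1)
  have hγ₂ : ∀ n, γ₂ n = 0 := fun n =>
    (mul_eq_zero.1 (hw₁ n).symm).resolve_right (ne_zero_of_mul_conj (hxv₁ n))
  have hn₀ := fun n => norm_of_mul_conj (hxv₀ n)
  have hn₁ := fun n => norm_of_mul_conj (hxv₁ n)
  have hη₀' := sqrt_neg_inv_ne hx₀ hη₀
  have hη₁' := sqrt_neg_inv_ne hx₁ hη₁
  obtain ⟨v₂, ℓ₂, hℓ₂, hv₂, hb₂, hc₂, hclose⟩ : ∃ (v₂ : ℤ → ℂ) (ℓ₂ : ℝ), ℓ₂ ≠ η ∧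
      (∀ n, ‖v₂ n‖ = ℓ₂) ∧
      (∀ n, v₂ (n + 1) * conj (cEdge f n + v₀ (n + 1) - v₀ n + v₁ (n + 1) - v₁ n - v₂ n) =
        (cEdge f n + v₀ (n + 1) - v₀ n + v₁ (n + 1) - v₁ n - v₂ n) * conj (v₂ n)) ∧
      (∀ n, c₂ n = E * v₂ n) ∧
      ∀ n, E * (cEdge f n + v₀ (n + 1) - v₀ n + v₁ (n + 1) - v₁ n + v₂ (n + 1) - v₂ n) =
        cEdge f n * conj E := by
    -- If w = 0, two factors exhaust the polynomial, and the third step is the identity v₂ = 0. It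
    -- is an admissible butterfly: the bisector of each edge swaps its endpoints.
    rcases h2 with hw | ⟨x₂, hx₂, h20, h21, hη₂, hd₂, hA₂⟩
    · have hγ₁' : ∀ n, γ₁ n = 0 := fun n =>
        (mul_eq_zero.1 ((hw₀ n).symm.trans (hw n))).resolve_right (ne_zero_of_mul_conj (hxv₀ n))
      have hc₂ : ∀ n, c₂ n = 0 := fun n => by
        have := hγ₁ n
        rw [hγ₁', hγ₂, zero_sub, zero_eq_neg] at this
        exact (mul_eq_zero.1 this).resolve_right
          ((map_ne_zero _).2 (ne_zero_of_mul_conj (hxv₁ n)))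
      refine ⟨0, 0, hf.pos.ne, by simp, by simp, by simpa using hc₂, fun n => ?_⟩
      have := h₂.one n
      rw [hc₂, hc₂] at this
      simpa using this
    · have hq₂ := fun n => polyDet_quotient (hxv₀ n) (hc₀ n) (hγ₀ n) (hw₀ n) h20 hx₂.ne (hd₂ n)
        (hA₂ n)
      have hq₂' := fun n => polyDet_quotient (hxv₁ n) (hc₁ n) (hγ₁ n) (hw₁ n) h21 hx₂.ne (hq₂ n).1
        (hq₂ n).2
      obtain ⟨v₂, c₃, γ₃, hxv₂, hb₂, hc₂, hγ₂', hw₂, h₃⟩ :=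
        h₂.exists_factor (fun n => (hq₂' n).2) (fun n => (hq₂' n).1)
      have hγ₃ : ∀ n, γ₃ n = 0 := fun n =>
        (mul_eq_zero.1 (hw₂ n).symm).resolve_right (ne_zero_of_mul_conj (hxv₂ n))
      have hc₃ : ∀ n, c₃ n = 0 := fun n => by
        have := hγ₂' n
        rw [hγ₃, hγ₂, zero_sub, zero_eq_neg] at this
        exact (mul_eq_zero.1 this).resolve_right
          ((map_ne_zero _).2 (ne_zero_of_mul_conj (hxv₂ n)))
      refine ⟨v₂, √(-x₂⁻¹), sqrt_neg_inv_ne hx₂ hη₂, fun n => norm_of_mul_conj (hxv₂ n),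
        hb₂, fun n => by rw [hc₂, hc₃, zero_add], fun n => ?_⟩
      have := h₃.one n
      rw [hc₃, hc₃] at this
      simpa using this
  obtain ⟨S, hSE, hS₀, hS₁, hS₂⟩ := exists_threeStep hf hE hη₀' hη₁' hℓ₂ hn₀ hn₁ hv₂
    (fun _ => rfl) (fun _ => rfl) (fun _ => rfl) hb₀ hb₁ hb₂ hclose
  refine ⟨S, hSE, fun n => ?_, fun n => ?_⟩
  · rw [ThreeStep.cOne, hSE, hS₀, hS₁, hS₂, hc₀, hc₁, hc₂]
  · rw [ThreeStep.cThree, hSE, hS₀, hS₁, hS₂, hw₀, hγ₁, hγ₂, hc₂, zero_sub]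

theorem polyDet_of_coordinates {u : ℂ} {η : ℝ} (hu : u * conj u = (η : ℂ) ^ 2)
    (ρ₀ ρ ε y X Y Z V t : ℝ) :
    polyDet (ρ₀ + I * ε) (u * (X + I * Y)) (ρ + I * y) (u * (Z + I * V)) t =
      (((ρ₀ + t * ρ) ^ 2 + (ε ^ 2 + (2 * ε * y + η ^ 2 * (X ^ 2 + Y ^ 2)) * t +
        (y ^ 2 + 2 * η ^ 2 * (X * Z + Y * V)) * t ^ 2 + η ^ 2 * (Z ^ 2 + V ^ 2) * t ^ 3) : ℝ) : ℂ) := by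
  simp only [polyDet, map_add, map_mul, Complex.conj_I, Complex.conj_ofReal]
  push_cast
  linear_combination (t * ((X + I * Y + t * (Z + I * V)) * (X - I * Y + t * (Z - I * V)))) * hu -
    ((ε + t * y) ^ 2 + t * η ^ 2 * (Y + t * V) ^ 2) * Complex.I_sq

/-- Normalizing β = 2η² determines y, Y, V from K, and Z from X; the choice of X solves the equation
for X_{n+1}. The remaining equations for Y_{n+1} and V_{n+1} become the elastic equation. -/
theorem IsAreaConstrainedElastic.exists_closedCoordinates {η : ℝ} {f : ℤ → Plane} (hη : 0 < η)
    (hel : IsAreaConstrainedElastic η f) : ∃ ε k : ℝ, ε ≠ 0 ∧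
      ClosedCoordinates η ε (halfCurvature η f)
        (fun n => k - halfCurvature η f n * halfCurvature η f (n + 1))
        (fun n => ε - (halfCurvature η f (n + 1) - halfCurvature η f n))
        (fun n => η ^ 2 * (k - halfCurvature η f n * halfCurvature η f (n + 1) + 2))
        (fun n => η ^ 2 * (ε - halfCurvature η f n - halfCurvature η f (n + 1)))
        (fun n => η ^ 2 * (ε - 2 * halfCurvature η f n)) := by
  obtain ⟨ξ, δ, hδ, hel⟩ := hel
  have hK : ∀ n, (halfCurvature η f n + halfCurvature η f (n + 1 + 1)) *
      (1 + halfCurvature η f (n + 1) ^ 2) = ξ * halfCurvature η f (n + 1) + η * δ / 2 := by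
    intro n
    have h := hel (n + 1)
    have hpos : 1 + η ^ 2 / 4 * curvature f (n + 1) ^ 2 ≠ 0 := by positivity
    rw [add_sub_cancel_right, eq_div_iff hpos] at h
    simp only [halfCurvature]
    linear_combination η / 2 * h
  -- The equation for Y_{n+1} reads (K_n + K_{n+2})(1 + K_{n+1}²) = (2k + 2)K_{n+1} + 2ε, which
  -- fixes k and ε. Here δ ≠ 0 makes ε ≠ 0.
  refine ⟨η * δ / 4, ξ / 2 - 1, by positivity, fun n => ?_, fun n => ?_, fun n => ?_, fun n => ?_,
    fun n => ?_, fun n => ?_⟩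
  · ring
  · linear_combination -hK n
  · ring
  · linear_combination -η ^ 2 * hK n
  · ring
  · ring

/-- The scalar part is chosen as ρ(λ² + 1/η²). It vanishes at λ² = -1/η², so the determinant stays
negative there, and at every other real λ² it keeps the even part nonzero, as the factorization
requires. -/
theorem exists_threeStep_of_closedCoordinates {η ε : ℝ} {f : ℤ → Plane} {X Y Z V y : ℤ → ℝ}
    (hf : IsArcLengthCurve η f) (h : ClosedCoordinates η ε (halfCurvature η f) X Y Z V y)
    (hε : ε ≠ 0)
    (hneg : ε ^ 2 + (2 * ε * y 0 + η ^ 2 * (X 0 ^ 2 + Y 0 ^ 2)) * (-(1 / η ^ 2)) +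
      (y 0 ^ 2 + 2 * η ^ 2 * (X 0 * Z 0 + Y 0 * V 0)) * (-(1 / η ^ 2)) ^ 2 +
      η ^ 2 * (Z 0 ^ 2 + V 0 ^ 2) * (-(1 / η ^ 2)) ^ 3 < 0) :
    ∃ S : ThreeStep η f, S.cE.im = ε ∧ (∀ n, S.cOne n = cEdge f n * (X n + I * Y n)) ∧
      ∀ n, S.cThree n = cEdge f n * (Z n + I * V n) := by
  have hη := hf.pos.ne'
  obtain ⟨ρ, x₀, x₁, hx₀, hx₁, h01, hη₀, hη₁, hd₀, hd₁, hρ, hthird⟩ :=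
    exists_real_zeros (one_div_pos.2 (pow_pos hf.pos 2)) hneg
  have hint : Intertwines ((ρ / η ^ 2 : ℝ) + I * ε) (cEdge f) (cEdge f)
      (fun n => cEdge f n * (X n + I * Y n)) (fun n => ρ + I * y n)
      (fun n => cEdge f n * (Z n + I * V n)) :=
    (intertwines_iff_closedCoordinates (K := halfCurvature η f) hη hf.cEdge_mul_conj
      hf.cEdge_rotation).2 h
  have hdet : ∀ t : ℝ, ρ ^ 2 * (t + 1 / η ^ 2) ^ 2 +
      (ε ^ 2 + (2 * ε * y 0 + η ^ 2 * (X 0 ^ 2 + Y 0 ^ 2)) * t +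
      (y 0 ^ 2 + 2 * η ^ 2 * (X 0 * Z 0 + Y 0 * V 0)) * t ^ 2 +
      η ^ 2 * (Z 0 ^ 2 + V 0 ^ 2) * t ^ 3) = 0 → ∀ n,
      polyDet ((ρ / η ^ 2 : ℝ) + I * ε) (cEdge f n * (X n + I * Y n)) (ρ + I * y n)
        (cEdge f n * (Z n + I * V n)) t = 0 := by
    intro t ht n
    rw [polyDet_of_coordinates (hf.cEdge_mul_conj n), h.theta_two n 0, h.theta_four hη n 0,
      h.theta_six n 0, Complex.ofReal_eq_zero, ← ht]
    ring
  have hA : ∀ t : ℝ, t ≠ -(1 / η ^ 2) → ∀ n,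
      ((ρ / η ^ 2 : ℝ) + I * ε : ℂ) + t * (ρ + I * y n) ≠ 0 := by
    intro t ht n h0
    have h1 := congrArg Complex.re h0
    simp only [Complex.add_re, Complex.ofReal_re, Complex.mul_re, Complex.I_re, Complex.ofReal_im,
      Complex.I_im, Complex.add_im, Complex.mul_im, Complex.zero_re] at h1
    have h3 : ρ * (t + 1 / η ^ 2) = 0 := by linear_combination h1
    apply ht
    linear_combination (mul_eq_zero.1 h3).resolve_left hρ
  have him : ((ρ / η ^ 2 : ℝ) + I * ε : ℂ).im = ε := by
    rw [Complex.add_im, Complex.ofReal_im, zero_add, Complex.mul_im, Complex.I_re, Complex.I_im,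
      Complex.ofReal_re, zero_mul, zero_add, one_mul]
  have hE : ((ρ / η ^ 2 : ℝ) + I * ε : ℂ) ≠ 0 := fun h0 => hε (by
    rw [← him, h0, Complex.zero_im])
  have hw : (∀ n, cEdge f n * (Z n + I * V n) = 0) ∨ ∃ x₂ < 0, x₂ ≠ x₀ ∧ x₂ ≠ x₁ ∧
      x₂ ≠ -(1 / η ^ 2) ∧ (∀ n, polyDet ((ρ / η ^ 2 : ℝ) + I * ε) (cEdge f n * (X n + I * Y n))
        (ρ + I * y n) (cEdge f n * (Z n + I * V n)) x₂ = 0) ∧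
      ∀ n, ((ρ / η ^ 2 : ℝ) + I * ε : ℂ) + x₂ * (ρ + I * y n) ≠ 0 := by
    have hpos : 0 ≤ η ^ 2 * (Z 0 ^ 2 + V 0 ^ 2) := by positivity
    rcases hpos.eq_or_lt with h0 | h0
    · left
      intro n
      rw [← h.theta_six n 0] at h0
      have h1 : Z n ^ 2 + V n ^ 2 = 0 :=
        (mul_eq_zero.1 h0.symm).resolve_left (pow_ne_zero 2 hη)
      have hZ0 : Z n = 0 := by nlinarith [sq_nonneg (Z n), sq_nonneg (V n)]
      have hV0 : V n = 0 := by nlinarith [sq_nonneg (Z n), sq_nonneg (V n)]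
      rw [hZ0, hV0]
      simp
    · right
      obtain ⟨x₂, hx₂, h20, h21, hη₂, hd₂⟩ := hthird h0
      exact ⟨x₂, hx₂, h20, h21, hη₂, hdet x₂ hd₂, hA x₂ hη₂⟩
  obtain ⟨S, hSE, hS⟩ := exists_threeStep_of_intertwines hf hE hint hx₀ hx₁ h01 hη₀ hη₁
    (hdet x₀ hd₀) (hA x₀ hη₀) (hdet x₁ hd₁) (hA x₁ hη₁) hw
  exact ⟨S, by rw [hSE, him], hS⟩

theorem exists_nondegenerate_threeStep {η : ℝ} {f : ℤ → Plane} (hf : IsArcLengthCurve η f)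
    (hel : IsAreaConstrainedElastic η f) :
    ∃ S : ThreeStep η f, S.IsRegular ∧ S.IsNondegenerate ∧ S.E.imK ≠ 0 := by
  obtain ⟨ε, k, hε, h⟩ := hel.exists_closedCoordinates hf.pos
  have hη := hf.pos.ne'
  obtain ⟨S, hSE, hS1, hS3⟩ := exists_threeStep_of_closedCoordinates hf h hε (by
    -- The value is -β²/η⁴ with β = 2η².
    refine lt_of_eq_of_lt (b := -4) ?_ (by norm_num)
    generalize halfCurvature η f 0 = a
    generalize halfCurvature η f (0 + 1) = b
    field_simp
    ring)
  have hSK : S.E.imK ≠ 0 := by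
    rw [← hSE] at hε
    exact hε
  refine ⟨S, ⟨0, 0, fun h0 => hSK ?_⟩, fun n hn => ?_, hSK⟩
  · have := congrArg QuaternionAlgebra.imK h0
    rwa [S.coeff_zero] at this
  · obtain ⟨β, -, hT, hdetS⟩ := S.exists_beta hf
    -- The β of the constructed sequence is read off from C³ - η²C¹ = βT at n = 0, where T does not
    -- vanish.
    have hβ : β = 2 * η ^ 2 := by
      have h0 := hT 0
      have h1 : (2 * η ^ 2 : ℝ) * cTangent f 0 = β * cTangent f 0 := by
        rw [← h0, hS1, hS3, hf.cTangent_eq]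
        simp only [halfCurvature]
        push_cast
        ring
      have hT0 : cTangent f 0 ≠ 0 := by
        rw [hf.cTangent_eq]
        refine mul_ne_zero (fun h2 => ?_) (hf.cEdge_ne_zero 0)
        have := congrArg Complex.re h2
        simp at this
      exact_mod_cast (mul_right_cancel₀ hT0 h1).symm
    rw [hdetS, neg_eq_zero, Complex.ofReal_eq_zero, hβ] at hn
    have : (2 * η ^ 2) ^ 2 / η ^ 4 = 4 := by field_simp; norm_num
    rw [this] at hn
    norm_num at hn

end DiscreteCurve

end

theorem mainTheorem9 (η : ℝ) (f : ℤ → Plane) (hf : IsArcLengthCurve η f)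
    (hel : IsAreaConstrainedElastic η f) :
    -- `f` is invariant under a linear combination of the mKdV flow and the tangent flow
    (∃ a b : ℝ, a ≠ 0 ∧
      IsInvariantUnderFlow (fun g n => a • mKdVFlow g n + b • tangentFlow g n) f) ∧
    -- `f` is 3-invariant, and the isometry can be taken to be a rotation
    (∃ S : ThreeStep η f, S.IsRegular ∧ S.IsNondegenerate ∧ S.E.imK ≠ 0) ∧
    -- degenerate sequences occur for discrete circles only
    ((∃ m n, curvature f m ≠ curvature f n) →
      ∀ S : ThreeStep η f, S.IsRegular → S.IsNondegenerate) ∧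
    -- the coefficients of the linear combination in terms of the invariants `θ_j` and `β`
    (∀ S : ThreeStep η f, S.IsRegular → S.IsNondegenerate →
      ∃ (θ : ℕ → ℝ) (β : ℝ),
        (∀ j n, S.theta j n = θ j) ∧
        β ≠ 0 ∧
        (∀ n, (β : ℂ) ^ 2 = -(-(η : ℂ) ^ 2) ^ 2 * S.detVec n) ∧
        (∀ n, S.coeff 3 n - η ^ 2 • S.coeff 1 n = β • tangentFlow f n) ∧
        (∀ n, S.coeff 1 n = (-β / (2 * η ^ 2)) • mKdVFlow f n +
          (1 / (2 * β * η ^ 4) * (θ 6 - η ^ 4 * θ 2 + 2 * η ^ 6 * θ 0)) • tangentFlow f n) ∧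
        -- the field `C¹` is the restriction of an infinitesimal Euclidean motion to `f`
        (∃ c : Plane, ∀ n, S.coeff 1 n =
          toQuat (f n) * S.E - S.E * toQuat (f n) + toQuat c) ∧
        IsInvariantUnderFlow (fun g n => (-β / (2 * η ^ 2)) • mKdVFlow g n +
          (1 / (2 * β * η ^ 4) * (θ 6 - η ^ 4 * θ 2 + 2 * η ^ 6 * θ 0)) • tangentFlow g n) f) := by
  obtain ⟨S, hreg, hnd, hE⟩ := exists_nondegenerate_threeStep hf hel
  refine ⟨?_, ⟨S, hreg, hnd, hE⟩, fun hκ S hS => S.isNondegenerate_of_curvature_ne hf hκ hS,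
    fun S _ hS => S.exists_invariants hf hS⟩
  obtain ⟨θ, β, -, hβ, -, -, -, -, hinv⟩ := S.exists_invariants hf hnd
  exact ⟨_, _, div_ne_zero (neg_ne_zero.2 hβ) (by have := hf.pos; positivity), hinv⟩
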